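/- Let $T=(V,E)$ be a tree with finite vertex set $V$ (the parties), let $r\in V$ be any vertex, chosen as root, and let $|\psi\rangle\in\bigotimes_{v\in V}\mathbb{C}^{d_v}$ be a unit vector, $\psi=|\psi\rangle\langle\psi|$. For a family $m=(m_e)_{e\in E}$ of positive integers let $$|\Phi_m\rangle=\bigotimes_{e\in E}|\Phi^+_{m_e}\rangle^e,\qquad |\Phi^+_{m_e}\rangle^e=\frac1{\sqrt{m_e}}\sum_{l=0}^{m_e-1}|l\rangle^{u}\otimes|l\rangle^{v}\quad(e=\{u,v\}),$$ so that each edge carries a maximally entangled state of Schmidt rank $m_e$ shared by its two end points. Call $m$ feasible if some LOCC operation among the parties $V$ (a protocol of finitely many rounds of local measurements and local operations that may depend on all earlier, broadcast, outcomes) transforms $|\Phi_m\rangle$ deterministically and exactly into $\psi$, and call $m$ optimal if it is feasible and minimizes $\sum_{e\in E}\log_2 m_e$ among all feasible families. For an optimal configuration $i=(m_e(i))_{e\in E}$ the exact edge graph-associated entanglement cost of $\psi$ at $e$ is $E^{T}_{\mathrm{GC},i,e}(\psi)=\log_2 m_e(i)$. For $e\in E$ let $R_e=\operatorname{rank}\rho_e$,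 where $\rho_e$ is the reduced density operator of $\psi$ on the parties that are separated from $r$ when $e$ is removed from $T$ (equivalently, $R_e$ is the Schmidt rank of $|\psi\rangle$ for the bipartition of $V$ obtained by removing $e$). Then there is exactly one optimal configuration $i$, and for every edge $e\in E$ $$E^{T}_{\mathrm{GC},i,e}(\psi)=\log_2 R_e .$$ -/

import Mathlib

open scoped Matrix

/-- A finite-dimensional quantum system with a chosen computational basis `|l⟩`, `l : Idx`;
its Hilbert space is `ℂ^Idx`. -/
structure LocalSystem where
  Idx : Type
  [fintype : Fintype Idx]
  [decEq : DecidableEq Idx]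

attribute [instance] LocalSystem.fintype LocalSystem.decEq

/-- The `d`-dimensional system. -/
abbrev qudit (d : ℕ) : LocalSystem := { Idx := Fin d }

/-- Index set of the computational product basis of the joint system `⨂ v, D v`. -/
abbrev Joint {V : Type} (D : V → LocalSystem) : Type := ∀ v, (D v).Idx

/-- The rank-one operator `|φ⟩⟨φ|`. -/
def pureState {I : Type} (φ : I → ℂ) : Matrix I I ℂ := Matrix.vecMulVec φ (star φ)

/-- The product operator `⨂ v, A v`. -/
def tensorOp {V : Type} [Fintype V] {D E : V → LocalSystem}
    (A : ∀ v, Matrix (E v).Idx (D v).Idx ℂ) : Matrix (Joint E) (Joint D) ℂ :=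
  Matrix.of fun x y => ∏ v, A v (x v) (y v)

/-- LOCC protocols (finitely many rounds, finitely many outcomes per round) among the parties `V`,
starting from the systems `D` and ending with the systems `T`.

In a round, one party `v` performs on its system the measurement with measurement operators
`A j v`, and broadcasts the outcome `j`; each other party `w` then applies an isometry `A j w`,
which may depend on `j` and may append an auxiliary system. All later rounds may depend on `j`,
and so may the resulting local systems `E j`. A party that wants to discard a system, or to apply
any other quantum channel, measures and has the later rounds ignore the outcome. -/
inductive LOCC {V : Type} (T : V → LocalSystem) : (V → LocalSystem) → Type 1
  | done : LOCC T T
  | round {D : V → LocalSystem} (v : V) (n : ℕ) (E : Fin n → V → LocalSystem)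
      (A : ∀ (j : Fin n) (w : V), Matrix (E j w).Idx (D w).Idx ℂ)
      (complete : ∑ j, (A j v)ᴴ * A j v = 1)
      (isometry : ∀ j w, w ≠ v → (A j w)ᴴ * A j w = 1)
      (next : ∀ j, LOCC T (E j)) : LOCC T D

/-- The deterministic operation implemented by an LOCC protocol: the sum over all
sequences of measurement outcomes. -/
def LOCC.channel {V : Type} [Fintype V] [DecidableEq V] {T : V → LocalSystem} :
    {D : V → LocalSystem} → LOCC T D →
      Matrix (Joint D) (Joint D) ℂ → Matrix (Joint T) (Joint T) ℂ
  | _, .done, ρ => ρ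
  | _, .round _ _ _ A _ _ next, ρ =>
      ∑ j, (next j).channel (tensorOp (A j) * ρ * (tensorOp (A j))ᴴ)

section Network

variable {V : Type} [Fintype V] [DecidableEq V] (G : SimpleGraph V) [DecidableRel G.Adj]

/-- For edge dimensions `m`, party `v` holds one `m e`-dimensional system for every edge `e`
incident to `v`. -/
abbrev resourceSystem (m : G.edgeSet → ℕ+) (v : V) : LocalSystem :=
  { Idx := ∀ e : {e : G.edgeSet // v ∈ (e : Sym2 V)}, Fin (m e.1) }

/-- The resource state `⨂ e, (1/√(m e)) ∑ l, |l⟩ ⊗ |l⟩`: one maximally entangled state for each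
edge, whose two halves belong to the two end points of the edge. -/
noncomputable def resourceState (m : G.edgeSet → ℕ+) : Joint (resourceSystem G m) → ℂ :=
  fun x => ∏ e : G.edgeSet,
    if ∀ (u v : V) (hu : u ∈ (e : Sym2 V)) (hv : v ∈ (e : Sym2 V)), x u ⟨e, hu⟩ = x v ⟨e, hv⟩
    then ((1 / √(m e : ℝ) : ℝ) : ℂ) else 0

/-- The edge dimensions `m` (that is, the resource states) for which the exact state
construction task under `G` for the target `ρ` is achievable. -/
def constructibleFrom {T : V → LocalSystem} (ρ : Matrix (Joint T) (Joint T) ℂ) :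
    Set (G.edgeSet → ℕ+) :=
  {m | ∃ P : LOCC T (resourceSystem G m), P.channel (pureState (resourceState G m)) = ρ}

/-- Total amount of entanglement of the resource state, in ebits. -/
noncomputable def totalEntanglement (m : G.edgeSet → ℕ+) : ℝ :=
  ∑ e : G.edgeSet, Real.logb 2 (m e : ℝ)

/-- The optimal resource configurations: those that attain the minimum of the total amount of
entanglement among all resource states from which `ρ` can be constructed exactly. -/
def optimalConfigurations {T : V → LocalSystem} (ρ : Matrix (Joint T) (Joint T) ℂ) :
    Set (G.edgeSet → ℕ+) :=
  {m | m ∈ constructibleFrom G ρ ∧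
    ∀ m' ∈ constructibleFrom G ρ, totalEntanglement G m ≤ totalEntanglement G m'}

/-- The exact edge graph-associated entanglement cost of `ρ` at the edge `e`, for the optimal
configuration `i`. -/
noncomputable def exactEdgeCost {T : V → LocalSystem} (ρ : Matrix (Joint T) (Joint T) ℂ)
    (i : optimalConfigurations G ρ) (e : G.edgeSet) : ℝ :=
  Real.logb 2 (i.1 e : ℝ)

end Network

open Classical in
/-- In a tree with root `r`: the vertices separated from `r` by removing the edge `e`.
For `e = {p(v), v}` these are `v` and all descendants of `v`. -/
noncomputable def farSide {V : Type} [Fintype V] (G : SimpleGraph V) (r : V) (e : G.edgeSet) :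
    Finset V :=
  {w | ¬ (G.deleteEdges {(e : Sym2 V)}).Reachable r w}

/-- The reduced operator of `ρ` on the parties in `S`: the partial trace over all other parties. -/
def reducedState {V : Type} [Fintype V] [DecidableEq V] {T : V → LocalSystem} (S : Finset V)
    (ρ : Matrix (Joint T) (Joint T) ℂ) :
    Matrix (∀ v : {v // v ∈ S}, (T v).Idx) (∀ v : {v // v ∈ S}, (T v).Idx) ℂ :=
  Matrix.of fun x y => ∑ z : (∀ v : {v // v ∉ S}, (T v).Idx),
    ρ ((Equiv.piEquivPiSubtypeProd (· ∈ S) fun v => (T v).Idx).symm (x, z))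
      ((Equiv.piEquivPiSubtypeProd (· ∈ S) fun v => (T v).Idx).symm (y, z))

/-- `R_e`: the rank of the reduced operator on the side of the edge `e` away from the root `r`;
for a pure state, the Schmidt rank for the bipartition obtained by removing `e`. -/
noncomputable def edgeRank {V : Type} [Fintype V] [DecidableEq V] (G : SimpleGraph V)
    {T : V → LocalSystem} (r : V) (ρ : Matrix (Joint T) (Joint T) ℂ) (e : G.edgeSet) : ℕ :=
  (reducedState (farSide G r e) ρ).rank

/-! Write `R e` for the Schmidt rank of `ψ` across `e`. The proof shows that `R` is feasible and is
a lower bound, edge by edge, for every feasible family. As the logarithm is strictly increasing, `R`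
is then the only optimum.

Lower bound. An LOCC channel has product Kraus operators (`LOCC.exists_kraus`). If its output is the
pure state `ψ`, every Kraus branch is proportional to `ψ`, so `ψ` is, up to a scalar, a product
operator applied to the resource state (`LOCC.exists_tensorOp_mulVec`). Once the label of `e` is
fixed, no other edge crosses the cut at `e`, so the Schmidt rank is at most `m e`
(`rank_schmidtMatrix_le_of_tensorOp`).

Feasibility. Orthonormal bases of the supports of `ψ` below the edges turn `ψ` into a tree tensor
network with bond dimensions `R e` (`eq_expect_prod_vertexTensor`). Each vertex tensor is, up to a
scalar, an isometry from the parent edge to the child edges and the local system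
(`vertexTensor_isometry`). Read as an operator from all edges at `v` to the local system, and
preceded by all generalized Pauli operators on the child edges, it becomes a complete measurement
(`sum_vertexOp_pauliOp`). The Pauli operators, corrected at the other ends, fix the resource state
(`tensorOp_pauliOp_mulVec`), so all outcomes leave the same state. Measuring from the root down
contracts the network to a multiple of `ψ`, and trace preservation makes the output exactly `ψ`.

Vectors on part of the system are functions on the whole product basis that ignore the other
coordinates. Uniform averages replace sums, so that ignored coordinates contribute no factors. -/

open scoped Matrix BigOperators

set_option linter.unusedSectionVars false

/-! ### Uniform averages over product sets -/

section Average

variable {ι : Type} [Fintype ι] [DecidableEq ι] {α : ι → Type} [∀ i, Fintype (α i)]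

/-- Exchanging the coordinates in `s` of two points. -/
def swapOn (s : Finset ι) : ((∀ i, α i) × (∀ i, α i)) ≃ ((∀ i, α i) × (∀ i, α i)) where
  toFun p := (s.piecewise p.2 p.1, s.piecewise p.1 p.2)
  invFun p := (s.piecewise p.2 p.1, s.piecewise p.1 p.2)
  left_inv p := by
    ext i <;> by_cases h : i ∈ s <;> simp [h]
  right_inv p := by
    ext i <;> by_cases h : i ∈ s <;> simp [h]

variable [∀ i, Nonempty (α i)]

/-- Resampling the coordinates in `s` preserves the uniform distribution, because `swapOn s`
permutes the pairs of points. -/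
theorem expect_expect_piecewise (s : Finset ι) (k : (∀ i, α i) → ℂ) :
    𝔼 x, 𝔼 y, k (s.piecewise y x) = 𝔼 x, k x := by
  have h1 : 𝔼 p : (∀ i, α i) × (∀ i, α i), k (s.piecewise p.2 p.1)
      = 𝔼 p : (∀ i, α i) × (∀ i, α i), k p.1 :=
    Fintype.expect_equiv (swapOn s) _ _ fun p => rfl
  have h2 := Finset.expect_product' Finset.univ Finset.univ
    fun x y : (∀ i, α i) => k (s.piecewise y x)
  have h3 := Finset.expect_product' Finset.univ Finset.univ
    fun x _ : (∀ i, α i) => k x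
  rw [Finset.univ_product_univ] at h2 h3
  rw [← h2, h1, h3]
  simp

/-- Independence: after the coordinates in `t` are resampled, `f` sees only the old point and `g`
only the new one. -/
theorem expect_mul_of_dependsOn {s t : Finset ι} (hst : Disjoint s t) {f g : (∀ i, α i) → ℂ}
    (hf : DependsOn f s) (hg : DependsOn g t) :
    𝔼 x, f x * g x = (𝔼 x, f x) * 𝔼 x, g x := by
  rw [← expect_expect_piecewise t, Fintype.expect_mul_expect]
  refine Finset.expect_congr rfl fun x _ => Finset.expect_congr rfl fun y _ => ?_
  congr 1
  · refine hf fun i hi => ?_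
    rw [Finset.piecewise_eq_of_notMem]
    exact Finset.disjoint_left.1 hst hi
  · refine hg fun i hi => ?_
    rw [Finset.piecewise_eq_of_mem _ _ _ hi]

theorem DependsOn.finset_prod {κ : Type} {β : κ → Type} {J : Type} (c : Finset J)
    {g : J → (∀ i, β i) → ℂ} {s : Set κ} (h : ∀ j ∈ c, DependsOn (g j) s) :
    DependsOn (fun x => ∏ j ∈ c, g j x) s :=
  fun _ _ hxy => Finset.prod_congr rfl fun j hj => h j hj hxy

theorem expect_prod_of_dependsOn {J : Type} [DecidableEq J] (c : Finset J) (F : J → Finset ι)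
    (hF : (c : Set J).PairwiseDisjoint F) {g : J → (∀ i, α i) → ℂ}
    (hg : ∀ j ∈ c, DependsOn (g j) (F j)) :
    𝔼 x, ∏ j ∈ c, g j x = ∏ j ∈ c, 𝔼 x, g j x := by
  induction c using Finset.induction_on with
  | empty => simp
  | insert a c ha ih =>
    simp only [Finset.prod_insert ha]
    have hd : Disjoint (F a) (c.biUnion F) := by
      rw [Finset.disjoint_biUnion_right]
      intro j hj
      exact hF (by simp) (by simp [hj]) (by rintro rfl; exact ha hj)
    rw [expect_mul_of_dependsOn hd (hg a (by simp)), ih]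
    · exact hF.subset (by simp)
    · exact fun j hj => hg j (by simp [hj])
    · refine DependsOn.finset_prod c fun j hj => (hg j (by simp [hj])).mono ?_
      exact_mod_cast Finset.subset_biUnion_of_mem F hj

theorem expect_apply_coord (i : ι) (f : α i → ℂ) : 𝔼 x : (∀ i, α i), f (x i) = 𝔼 a, f a := by
  let e := (Equiv.piSplitAt i α)
  have h1 : 𝔼 x : (∀ i, α i), f (x i) = 𝔼 p : α i × (∀ j : {j // j ≠ i}, α j), f p.1 :=
    Fintype.expect_equiv e _ _ fun p => rfl
  have h2 := Finset.expect_product' Finset.univ Finset.univ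
    fun (x : α i) (_ : ∀ j : {j // j ≠ i}, α j) => f x
  rw [Finset.univ_product_univ] at h2
  rw [h1, h2]
  simp

end Average

/-! ### Rooted trees: parents, descendants and cuts -/

section RootedTree

variable {V : Type} [Fintype V] [DecidableEq V] {G : SimpleGraph V} (r : V)

/-- In a tree with root `r`: the edge `e` joins the parent `u` to its child `w`. -/
def IsParentEdge (u w : V) (e : G.edgeSet) : Prop :=
  (e : Sym2 V) = s(u, w) ∧ u ∉ farSide G r e ∧ w ∈ farSide G r e

theorem mem_farSide {e : G.edgeSet} {x : V} :
    x ∈ farSide G r e ↔ ¬ (G.deleteEdges {(e : Sym2 V)}).Reachable r x := by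
  simp [farSide]

theorem root_notMem_farSide (e : G.edgeSet) : r ∉ farSide G r e := by
  simp [mem_farSide]

theorem mem_farSide_iff_of_ne {e f : G.edgeSet} (hef : f ≠ e) {u w : V}
    (hu : u ∈ (f : Sym2 V)) (hw : w ∈ (f : Sym2 V)) :
    u ∈ farSide G r e ↔ w ∈ farSide G r e := by
  rcases eq_or_ne u w with rfl | huw
  · rfl
  have hf : (f : Sym2 V) = s(u, w) := (Sym2.mem_and_mem_iff huw).1 ⟨hu, hw⟩
  have hadj : (G.deleteEdges {(e : Sym2 V)}).Adj u w := by
    rw [SimpleGraph.deleteEdges_adj]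
    refine ⟨by rw [← SimpleGraph.mem_edgeSet, ← hf]; exact f.2, ?_⟩
    rw [← hf]
    simpa [Subtype.ext_iff] using hef
  rw [mem_farSide, mem_farSide, not_iff_not]
  exact ⟨fun h => h.trans hadj.reachable, fun h => h.trans hadj.reachable.symm⟩

/-- A walk that avoids `e` shortens to the unique path, which then avoids `e` as well. -/
theorem mem_farSide_iff_mem_edges (hG : G.IsTree) {e : G.edgeSet} {x : V} {p : G.Walk r x}
    (hp : p.IsPath) : x ∈ farSide G r e ↔ (e : Sym2 V) ∈ p.edges := by
  rw [mem_farSide]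
  constructor
  · intro h
    by_contra he
    exact h ⟨p.toDeleteEdge _ he⟩
  · rintro he ⟨q⟩
    have hle : G.deleteEdges {(e : Sym2 V)} ≤ G := SimpleGraph.deleteEdges_le _
    have hq : (e : Sym2 V) ∉ (q.mapLe hle).edges := by
      rw [SimpleGraph.Walk.edges_mapLe_eq_edges]
      intro h
      have := q.edges_subset_edgeSet h
      simp at this
    have hb := (hG.existsUnique_path r x).unique hp (q.mapLe hle).bypass_isPath
    rw [hb] at he
    exact hq ((q.mapLe hle).edges_bypass_subset_edges he)

theorem isParentEdge_of_concat (hG : G.IsTree) {u w : V} {p : G.Walk r u} (h : G.Adj u w)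
    (hp : (p.concat h).IsPath) : IsParentEdge r u w ⟨s(u, w), h⟩ := by
  have hp' : p.IsPath := by
    rw [SimpleGraph.Walk.concat_eq_append] at hp
    exact hp.of_append_left
  refine ⟨rfl, ?_, ?_⟩
  · rw [mem_farSide_iff_mem_edges r hG hp']
    intro he
    have := hp.isTrail.edges_nodup
    rw [SimpleGraph.Walk.edges_concat, List.concat_eq_append, List.nodup_append] at this
    exact this.2.2 _ he _ (by simp) rfl
  · rw [mem_farSide_iff_mem_edges r hG hp]
    simp [SimpleGraph.Walk.edges_concat]

theorem exists_isParentEdge (hG : G.IsTree) {x : V} (hx : x ≠ r) :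
    ∃ u e, IsParentEdge (G := G) r u x e := by
  obtain ⟨p, hp, -⟩ := hG.existsUnique_path r x
  have hnn : ¬ p.Nil := SimpleGraph.Walk.not_nil_of_ne hx.symm
  have hc := SimpleGraph.Walk.concat_dropLast (SimpleGraph.Walk.adj_penultimate hnn)
  rw [← hc] at hp
  exact ⟨_, _, isParentEdge_of_concat r hG _ hp⟩

theorem isParentEdge_or (hG : G.IsTree) {u w : V} (h : G.Adj u w) :
    IsParentEdge r u w ⟨s(u, w), h⟩ ∨ IsParentEdge r w u ⟨s(u, w), h⟩ := by
  obtain ⟨p, hp, -⟩ := hG.existsUnique_path r u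
  obtain ⟨q, hq, -⟩ := hG.existsUnique_path r w
  by_cases hw : w ∈ p.support
  · right
    have hu : u ∉ q.support := by
      intro hu
      exact hG.isAcyclic.ne_mem_support_of_support_of_adj_of_isPath hp hq h hw hu
    have := isParentEdge_of_concat r hG h.symm (hq.concat hu h.symm)
    convert this using 2
    exact Subtype.ext Sym2.eq_swap
  · left
    exact isParentEdge_of_concat r hG h (hp.concat hw h)

theorem exists_isParentEdge_of_edge (hG : G.IsTree) (e : G.edgeSet) :
    ∃ u w, IsParentEdge r u w e := by
  obtain ⟨e, he⟩ := e
  induction e using Sym2.ind with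
  | _ a b =>
    rcases isParentEdge_or r hG he with h | h
    · exact ⟨_, _, h⟩
    · exact ⟨_, _, h⟩

theorem tree_induction (hG : G.IsTree) {motive : V → Prop} (root : motive r)
    (child : ∀ u w e, IsParentEdge (G := G) r u w e → motive u → motive w) (x : V) :
    motive x := by
  obtain ⟨p, hp, -⟩ := hG.existsUnique_path r x
  induction hn : p.length generalizing x with
  | zero =>
    have := SimpleGraph.Walk.eq_of_length_eq_zero hn
    exact this ▸ root
  | succ n ih =>
    have hnn : ¬ p.Nil := by
      rw [← SimpleGraph.Walk.length_eq_zero_iff]; omega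
    have hc := SimpleGraph.Walk.concat_dropLast (SimpleGraph.Walk.adj_penultimate hnn)
    rw [← hc] at hp hn
    rw [SimpleGraph.Walk.length_concat] at hn
    have hp' := hp
    rw [SimpleGraph.Walk.concat_eq_append] at hp'
    exact child _ _ _ (isParentEdge_of_concat r hG _ hp)
      (ih _ _ hp'.of_append_left (by omega))

variable {r}

theorem IsParentEdge.left_mem {u w : V} {e : G.edgeSet} (h : IsParentEdge r u w e) :
    u ∈ (e : Sym2 V) := by rw [h.1]; simp

theorem IsParentEdge.right_mem {u w : V} {e : G.edgeSet} (h : IsParentEdge r u w e) :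
    w ∈ (e : Sym2 V) := by rw [h.1]; simp

theorem IsParentEdge.eq_or_eq {u w v : V} {e : G.edgeSet} (h : IsParentEdge r u w e)
    (hv : v ∈ (e : Sym2 V)) : v = u ∨ v = w := by
  rw [h.1] at hv; simpa using hv

theorem IsParentEdge.eq_left {u w v : V} {e : G.edgeSet} (h : IsParentEdge r u w e)
    (hv : v ∈ (e : Sym2 V)) (hv' : v ∉ farSide G r e) : v = u :=
  (h.eq_or_eq hv).resolve_right fun h' => hv' (h' ▸ h.2.2)

theorem IsParentEdge.eq_right {u w v : V} {e : G.edgeSet} (h : IsParentEdge r u w e)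
    (hv : v ∈ (e : Sym2 V)) (hv' : v ∈ farSide G r e) : v = w :=
  (h.eq_or_eq hv).resolve_left fun h' => h.2.1 (h' ▸ hv')

theorem IsParentEdge.mem_farSide_iff {u w : V} {e f : G.edgeSet} (h : IsParentEdge r u w e) :
    w ∈ farSide G r f ↔ u ∈ farSide G r f ∨ f = e := by
  rcases eq_or_ne f e with rfl | hne
  · simp [h.2.2]
  · simp [hne, mem_farSide_iff_of_ne r hne.symm h.left_mem h.right_mem]

/-- Such an edge must be the last one on the path from the root to `v`. Otherwise that path could be
prolonged through the edge, which would put `v` on its near side. -/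
theorem parent_edge_unique (hG : G.IsTree) {v : V} {e f : G.edgeSet} (he : v ∈ (e : Sym2 V))
    (he' : v ∈ farSide G r e) (hf : v ∈ (f : Sym2 V)) (hf' : v ∈ farSide G r f) : e = f := by
  have key : ∀ v : V, v ≠ r → ∃ g : G.edgeSet, ∀ e : G.edgeSet, v ∈ (e : Sym2 V) →
      v ∈ farSide G r e → e = g := by
    intro v hv
    obtain ⟨p, hp, -⟩ := hG.existsUnique_path r v
    have hnn : ¬ p.Nil := SimpleGraph.Walk.not_nil_of_ne hv.symm
    refine ⟨⟨s(p.penultimate, v), SimpleGraph.Walk.adj_penultimate hnn⟩, fun e he he' => ?_⟩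
    obtain ⟨u, w, h⟩ := exists_isParentEdge_of_edge r hG e
    obtain rfl := h.eq_right he he'
    have hadj : G.Adj v u := by
      have := e.2; rw [h.1] at this; exact this.symm
    have : u = p.penultimate := by
      refine hG.isAcyclic.eq_penultimate_of_adj_end hp hadj ?_
      obtain ⟨q, hq, -⟩ := hG.existsUnique_path r u
      by_contra hu
      have h2 := isParentEdge_of_concat r hG hadj (hp.concat hu hadj)
      have h3 := h2.2.1
      apply h3
      convert he' using 2
      ext1
      rw [h.1]
      exact Sym2.eq_swap
    subst this
    exact Subtype.ext h.1
  have hv : v ≠ r := by rintro rfl; exact root_notMem_farSide v e he'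
  obtain ⟨g, hg⟩ := key v hv
  rw [hg e he he', hg f hf hf']

variable (r) in
/-- The edges from `v` to its children. -/
noncomputable def childEdges [DecidableRel G.Adj] (v : V) : Finset G.edgeSet :=
  {e | v ∈ (e : Sym2 V) ∧ v ∉ farSide G r e}

variable [DecidableRel G.Adj]

theorem mem_childEdges {v : V} {e : G.edgeSet} :
    e ∈ childEdges r v ↔ v ∈ (e : Sym2 V) ∧ v ∉ farSide G r e := by
  simp [childEdges]

theorem IsParentEdge.mem_childEdges_iff {u w v : V} {e : G.edgeSet} (h : IsParentEdge r u w e) :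
    e ∈ childEdges r v ↔ v = u := by
  rw [mem_childEdges]
  constructor
  · rintro ⟨h1, h2⟩; exact h.eq_left h1 h2
  · rintro rfl; exact ⟨h.left_mem, h.2.1⟩

theorem farSide_disjoint (hG : G.IsTree) (v : V) :
    (childEdges (G := G) r v : Set G.edgeSet).PairwiseDisjoint (farSide G r) := by
  intro e he f hf hef
  rw [Function.onFun, Finset.disjoint_left]
  intro x
  rw [Finset.mem_coe] at he hf
  induction x using tree_induction r hG with
  | root => intro h; exact absurd h (root_notMem_farSide r e)
  | child u w g h ih =>
    intro h1 h2
    rw [h.mem_farSide_iff] at h1 h2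
    rcases h1 with h1 | rfl <;> rcases h2 with h2 | rfl
    · exact ih h1 h2
    · obtain rfl := h.mem_childEdges_iff.1 hf
      exact (mem_childEdges.1 he).2 h1
    · obtain rfl := h.mem_childEdges_iff.1 he
      exact (mem_childEdges.1 hf).2 h2
    · exact hef rfl

variable (r) in
/-- The vertex `v` and all its descendants. -/
noncomputable def descendants (v : V) : Finset V :=
  insert v ((childEdges r v).biUnion (farSide G r))

theorem mem_descendants {v x : V} :
    x ∈ descendants (G := G) r v ↔ x = v ∨ ∃ e ∈ childEdges r v, x ∈ farSide G r e := by
  simp [descendants]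

theorem IsParentEdge.mem_descendants_iff {u w v : V} {e : G.edgeSet}
    (h : IsParentEdge r u w e) :
    w ∈ descendants (G := G) r v ↔ w = v ∨ u ∈ descendants (G := G) r v := by
  simp only [mem_descendants, h.mem_farSide_iff]
  constructor
  · rintro (h1 | ⟨f, hf, h1 | rfl⟩)
    · exact .inl h1
    · exact .inr (.inr ⟨f, hf, h1⟩)
    · exact .inr (.inl (h.mem_childEdges_iff.1 hf).symm)
  · rintro (h1 | rfl | ⟨f, hf, h1⟩)
    · exact .inl h1
    · exact .inr ⟨e, h.mem_childEdges_iff.2 rfl, .inr rfl⟩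
    · exact .inr ⟨f, hf, .inl h1⟩

theorem mem_descendants_root (hG : G.IsTree) (x : V) : x ∈ descendants (G := G) r r := by
  induction x using tree_induction r hG with
  | root => simp [mem_descendants]
  | child u w g h ih => rw [h.mem_descendants_iff]; exact .inr ih

theorem IsParentEdge.farSide_eq (hG : G.IsTree) {u v : V} {e : G.edgeSet}
    (h : IsParentEdge r u v e) : farSide G r e = descendants (G := G) r v := by
  ext x
  induction x using tree_induction r hG with
  | root =>
    simp only [root_notMem_farSide, mem_descendants, and_false, exists_false, or_false,
      false_iff]
    rintro rfl
    exact root_notMem_farSide _ _ h.2.2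
  | child a b g h' ih =>
    rw [h'.mem_farSide_iff, h'.mem_descendants_iff, ih, or_comm]
    refine or_congr ?_ Iff.rfl
    constructor
    · rintro rfl; exact (h.eq_right h'.right_mem h'.2.2)
    · rintro rfl; exact parent_edge_unique hG h.right_mem h.2.2 h'.right_mem h'.2.2

variable (r) in
/-- The number of edges between `v` and the root. -/
noncomputable def treeDepth (v : V) : ℕ := Finset.card {e : G.edgeSet | v ∈ farSide G r e}

theorem IsParentEdge.treeDepth_lt {u w : V} {e : G.edgeSet} (h : IsParentEdge r u w e) :
    treeDepth (G := G) r u < treeDepth (G := G) r w := by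
  refine Finset.card_lt_card ?_
  rw [Finset.ssubset_iff_of_subset]
  · exact ⟨e, by simpa using h.2.2, by simpa using h.2.1⟩
  · intro f hf
    simp only [Finset.mem_filter, Finset.mem_univ, true_and] at hf ⊢
    rw [h.mem_farSide_iff]
    exact .inl hf

variable (G r) in
/-- Sets of vertices that contain the parent of each of their vertices. -/
def ParentClosed (S : Finset V) : Prop :=
  ∀ u w e, IsParentEdge (G := G) r u w e → w ∈ S → u ∈ S

/-- To build up a parent-closed set, vertices can be added such that the children are never
added before. -/
theorem parentClosed_induction {motive : Finset V → Prop} (empty : motive ∅)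
    (insert : ∀ v S, v ∉ S → ParentClosed G r S → ParentClosed G r (insert v S) →
      (∀ w e, IsParentEdge (G := G) r v w e → w ∉ S) → motive S → motive (insert v S))
    (S : Finset V) (hS : ParentClosed G r S) : motive S := by
  induction hn : S.card generalizing S with
  | zero => rw [Finset.card_eq_zero] at hn; exact hn ▸ empty
  | succ n ih =>
    -- A vertex of maximal depth has no child in `S`, so it can be the last one added.
    obtain ⟨v, hv, hmax⟩ := S.exists_max_image (treeDepth (G := G) r)
      (Finset.card_pos.1 (by omega))
    have hchild : ∀ w e, IsParentEdge (G := G) r v w e → w ∉ S := by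
      intro w e h hw
      exact absurd (hmax w hw) (not_le.2 h.treeDepth_lt)
    have hS' : ParentClosed G r (S.erase v) := by
      intro u w e h hw
      refine Finset.mem_erase.2 ⟨?_, hS u w e h (Finset.mem_of_mem_erase hw)⟩
      rintro rfl
      exact hchild w e h (Finset.mem_of_mem_erase hw)
    have := insert v (S.erase v) (by simp) hS' (by rwa [Finset.insert_erase hv])
      (fun w e h hw => hchild w e h (Finset.mem_of_mem_erase hw))
      (ih _ hS' (by rw [Finset.card_erase_of_mem hv]; omega))
    rwa [Finset.insert_erase hv] at this

end RootedTree

/-! ### Schmidt vectors of a bipartition -/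

section Schmidt

variable {V : Type} [Fintype V] [DecidableEq V] {α : V → Type} [∀ v, Fintype (α v)]
  [∀ v, DecidableEq (α v)]

/-- The coefficient matrix of `ψ` for the bipartition into `s` and its complement, with rows and
columns indexed by the whole product basis. -/
def schmidtMatrix (ψ : (∀ v, α v) → ℂ) (s : Finset V) : Matrix (∀ v, α v) (∀ v, α v) ℂ :=
  Matrix.of fun z x => ψ (s.piecewise x z)

/-- `f` is invariant under the operator `∑ t, |w t⟩⟨w t|` (normalized by averages), which acts on
the coordinates in `s`. -/
def FixedBy {κ : Type} [Fintype κ] (s : Finset V) (w : κ → (∀ v, α v) → ℂ)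
    (f : (∀ v, α v) → ℂ) : Prop :=
  ∀ x, f x = 𝔼 t, 𝔼 y, w t x * star (w t y) * f (s.piecewise y x)

theorem piecewise_piecewise_comm {s s' : Finset V} (h : s ⊆ s') (x y z : ∀ v, α v) :
    s.piecewise y (s'.piecewise x z) = s'.piecewise (s.piecewise y x) z := by
  ext v
  by_cases hv : v ∈ s
  · simp [hv, h hv]
  · by_cases hv' : v ∈ s' <;> simp [hv, hv']

theorem FixedBy.of_sum {κ : Type} [Fintype κ] {s : Finset V}
    {w : κ → (∀ v, α v) → ℂ} {J : Type} [Fintype J] (c : J → ℂ) {f : J → (∀ v, α v) → ℂ}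
    (h : ∀ j, FixedBy s w (f j)) : FixedBy s w (fun x => ∑ j, c j * f j x) := by
  intro x
  simp only [Finset.mul_sum]
  simp only [Finset.expect_sum_comm]
  refine Finset.sum_congr rfl fun j _ => ?_
  rw [h j x, Finset.mul_expect]
  refine Finset.expect_congr rfl fun t _ => ?_
  rw [Finset.mul_expect]
  refine Finset.expect_congr rfl fun y _ => ?_
  ring

theorem FixedBy.piecewise {κ : Type} [Fintype κ] {s s' : Finset V} (hs : s ⊆ s')
    {w : κ → (∀ v, α v) → ℂ} (hw : ∀ t, DependsOn (w t) s) {f : (∀ v, α v) → ℂ}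
    (h : FixedBy s w f) (z : ∀ v, α v) : FixedBy s w (fun x => f (s'.piecewise x z)) := by
  intro x
  simp only
  rw [h]
  refine Finset.expect_congr rfl fun t _ => Finset.expect_congr rfl fun y _ => ?_
  rw [piecewise_piecewise_comm hs]
  congr 2
  exact hw t fun i hi => Finset.piecewise_eq_of_mem _ _ _ (hs hi)

/-- Normalized Schmidt vectors on the side `s` of a bipartition. -/
structure IsSchmidtFamily {κ : Type} [Fintype κ] [DecidableEq κ] (ψ : (∀ v, α v) → ℂ)
    (s : Finset V) (w : κ → (∀ v, α v) → ℂ) : Prop where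
  dependsOn : ∀ t, DependsOn (w t) s
  orthonormal : ∀ t t', 𝔼 x, star (w t x) * w t' x = if t = t' then (Fintype.card κ : ℂ) else 0
  fixed : FixedBy s w ψ
  mem_span : ∀ t, ∃ g : (∀ v, α v) → ℂ, ∀ x, w t x = ∑ z, g z * ψ (s.piecewise x z)

/-- Any orthonormal basis of the row space of the coefficient matrix serves, since only the
projection onto that space matters. The Schmidt coefficients play no role. -/
theorem exists_isSchmidtFamily [∀ v, Nonempty (α v)] (ψ : (∀ v, α v) → ℂ) (s : Finset V) {n : ℕ}
    (hn : (schmidtMatrix ψ s).rank = n) :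
    ∃ w : Fin n → (∀ v, α v) → ℂ, IsSchmidtFamily ψ s w := by
  let e := (WithLp.linearEquiv 2 ℂ ((∀ v, α v) → ℂ)).symm
  let K : Submodule ℂ (EuclideanSpace ℂ (∀ v, α v)) :=
    Submodule.span ℂ (Set.range fun z => e ((schmidtMatrix ψ s).row z))
  have hK : Module.finrank ℂ K = n := by
    rw [← hn, Matrix.rank_eq_finrank_span_row]
    have : K = (Submodule.span ℂ (Set.range (schmidtMatrix ψ s).row)).map e.toLinearMap := by
      rw [Submodule.map_span, ← Set.range_comp]
      rfl
    rw [this]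
    exact LinearEquiv.finrank_map_eq e _
  let b := (stdOrthonormalBasis ℂ K).reindex (finCongr hK)
  -- Scaling the basis by `√N` compensates the averages over the `n` labels and over the product
  -- basis in `FixedBy`.
  set N : ℝ := n * Fintype.card (∀ v, α v) with hN
  have hN0 : 0 ≤ N := by positivity
  have hsq : ((√N : ℝ) : ℂ) * ((√N : ℝ) : ℂ) = n * Fintype.card (∀ v, α v) := by
    rw [← Complex.ofReal_mul, Real.mul_self_sqrt hN0, hN]; push_cast; rfl
  have hX : (Fintype.card (∀ v, α v) : ℂ) ≠ 0 := by
    exact_mod_cast Fintype.card_ne_zero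
  have hspan : ∀ t, ∃ g : (∀ v, α v) → ℂ, ∀ x, ((b t : EuclideanSpace ℂ (∀ v, α v)) x)
      = ∑ z, g z * ψ (s.piecewise x z) := by
    intro t
    obtain ⟨g, hg⟩ := (Submodule.mem_span_range_iff_exists_fun ℂ).1 (b t).2
    refine ⟨g, fun x => ?_⟩
    rw [← hg]
    simp [e, schmidtMatrix, Matrix.row]
  refine ⟨fun t x => (√N : ℝ) * (b t : EuclideanSpace ℂ (∀ v, α v)) x, ?_, ?_, ?_, ?_⟩
  · intro t x y hxy
    obtain ⟨g, hg⟩ := hspan t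
    simp only [hg]
    congr 1
    refine Finset.sum_congr rfl fun z _ => ?_
    congr 2
    ext v
    by_cases hv : v ∈ s
    · simp [hv, hxy v hv]
    · simp [hv]
  · intro t t'
    have h := orthonormal_iff_ite.1 b.orthonormal t t'
    rw [Submodule.coe_inner, PiLp.inner_apply] at h
    rw [Fintype.expect_eq_sum_div_card]
    simp only [star_mul', RCLike.star_def, Complex.conj_ofReal, RCLike.inner_apply] at h ⊢
    have h2 : ∀ x, (√N : ℝ) * (starRingEnd ℂ) ((b t : EuclideanSpace ℂ (∀ v, α v)) x) *
        ((√N : ℝ) * (b t' : EuclideanSpace ℂ (∀ v, α v)) x) =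
        (n * Fintype.card (∀ v, α v)) * ((b t' : EuclideanSpace ℂ (∀ v, α v)) x *
          (starRingEnd ℂ) ((b t : EuclideanSpace ℂ (∀ v, α v)) x)) := by
      intro x; rw [← hsq]; ring
    simp only [h2]
    rw [← Finset.mul_sum, h]
    split_ifs
    · rw [Fintype.card_fin]; field_simp
    · simp
  · intro x
    have hmem : e ((schmidtMatrix ψ s).row x) ∈ K := Submodule.subset_span ⟨x, rfl⟩
    have h := congrArg (fun k : K => (k : EuclideanSpace ℂ (∀ v, α v)) x)
      (b.sum_repr' ⟨_, hmem⟩)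
    simp only [Submodule.coe_sum, Submodule.coe_smul, Submodule.coe_inner, PiLp.inner_apply,
      WithLp.ofLp_sum, Finset.sum_apply, WithLp.ofLp_smul, Pi.smul_apply, smul_eq_mul,
      RCLike.inner_apply] at h
    have h0 : (e ((schmidtMatrix ψ s).row x)) x = ψ x := by
      change ψ (s.piecewise x x) = ψ x
      congr 1
      ext v
      by_cases hv : v ∈ s <;> simp [hv]
    rw [h0] at h
    rw [← h, Fintype.expect_eq_sum_div_card, Finset.sum_div]
    refine Finset.sum_congr rfl fun t _ => ?_
    rw [Fintype.expect_eq_sum_div_card, Finset.sum_div, Finset.sum_div, Finset.sum_mul]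
    refine Finset.sum_congr rfl fun y _ => ?_
    have hy : (e ((schmidtMatrix ψ s).row x)) y = ψ (s.piecewise y x) := by
      simp [e, schmidtMatrix, Matrix.row]
    rw [hy]
    have hn0 : (n : ℂ) ≠ 0 := by
      have := t.pos; exact_mod_cast this.ne'
    simp only [star_mul', RCLike.star_def, Complex.conj_ofReal, Fintype.card_fin]
    field_simp
    rw [sq, hsq]; ring
  · intro t
    obtain ⟨g, hg⟩ := hspan t
    refine ⟨fun z => (√N : ℝ) * g z, fun x => ?_⟩
    rw [hg, Finset.mul_sum]
    exact Finset.sum_congr rfl fun z _ => by ring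

/-- The vectors on `s'` are combinations of slices of `ψ` with the coordinates outside `s'` frozen,
and freezing those commutes with a projection on `s ⊆ s'`. -/
theorem IsSchmidtFamily.fixedBy {κ κ' : Type} [Fintype κ] [DecidableEq κ] [Fintype κ']
    [DecidableEq κ'] {ψ : (∀ v, α v) → ℂ} {s s' : Finset V} {w : κ → (∀ v, α v) → ℂ}
    {w' : κ' → (∀ v, α v) → ℂ} (h : IsSchmidtFamily ψ s w) (h' : IsSchmidtFamily ψ s' w')
    (hs : s ⊆ s') (t : κ') : FixedBy s w (w' t) := by
  obtain ⟨g, hg⟩ := h'.mem_span t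
  rw [show w' t = fun x => ∑ z, g z * ψ (s'.piecewise x z) from funext hg]
  exact FixedBy.of_sum g fun z => h.fixed.piecewise hs h.dependsOn z

end Schmidt

-- The reduced operator is `B * Bᴴ` for the usual coefficient matrix `B`, and `schmidtMatrix` is
-- `Bᵀ` with repeated rows and columns.
open scoped ComplexOrder in
theorem rank_reducedState {V : Type} [Fintype V] [DecidableEq V] {T : V → LocalSystem}
    (s : Finset V) (ψ : Joint T → ℂ) [∀ v, Nonempty (T v).Idx] :
    (reducedState s (pureState ψ)).rank = (schmidtMatrix (α := fun v => (T v).Idx) ψ s).rank := by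
  let e := Equiv.piEquivPiSubtypeProd (· ∈ s) fun v => (T v).Idx
  let B : Matrix (∀ v : {v // v ∈ s}, (T v).Idx) (∀ v : {v // v ∉ s}, (T v).Idx) ℂ :=
    Matrix.of fun x z => ψ (e.symm (x, z))
  have h1 : reducedState s (pureState ψ) = B * Bᴴ := by
    ext x y
    simp [reducedState, pureState, Matrix.vecMulVec, Matrix.mul_apply, B, e]
  rw [h1, Matrix.rank_self_mul_conjTranspose]
  have h2 : schmidtMatrix (α := fun v => (T v).Idx) ψ s
      = Bᵀ.submatrix (fun z => (e z).2) (fun x => (e x).1) := by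
    ext z x
    simp only [schmidtMatrix, Matrix.of_apply, Matrix.submatrix_apply, Matrix.transpose_apply, B]
    congr 1
  have x0 : Joint T := fun v => Classical.arbitrary _
  have h3 : Bᵀ = (schmidtMatrix (α := fun v => (T v).Idx) ψ s).submatrix
      (fun z => e.symm ((e x0).1, z)) (fun x => e.symm (x, (e x0).2)) := by
    rw [h2]
    ext z x
    simp
  rw [← Matrix.rank_transpose B]
  refine le_antisymm ?_ ?_
  · conv_lhs => rw [h3]
    exact Matrix.rank_submatrix_le _ _ _
  · rw [h2]
    exact Matrix.rank_submatrix_le _ _ _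

/-! ### Expansion in products of block vectors -/

section LocalTensor

theorem star_expect {J : Type} [Fintype J] (f : J → ℂ) : star (𝔼 j, f j) = 𝔼 j, star (f j) := by
  simp [Fintype.expect_eq_sum_div_card]

variable {V : Type} [Fintype V] [DecidableEq V] {α : V → Type} [∀ v, Fintype (α v)]
  [∀ v, Nonempty (α v)]
  {E : Type} [Fintype E] [DecidableEq E] {β : E → Type} [∀ e, Fintype (β e)]
  [∀ e, Nonempty (β e)] [∀ e, DecidableEq (β e)]

/-- The coefficients of `f` with respect to the products of the vectors `w c (l c)`, `c ∈ C`,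
which live on the blocks `F c` of coordinates. -/
noncomputable def blockCoeff (F : E → Finset V) (w : ∀ e, β e → (∀ v, α v) → ℂ) (C : Finset E)
    (f : (∀ v, α v) → ℂ) (x : ∀ v, α v) (l : ∀ e, β e) : ℂ :=
  𝔼 y, (∏ c ∈ C, star (w c (l c) y)) * f ((C.biUnion F).piecewise y x)

variable {F : E → Finset V} {w : ∀ e, β e → (∀ v, α v) → ℂ} {C : Finset E}

theorem blockCoeff_dependsOn_right (f : (∀ v, α v) → ℂ) (x : ∀ v, α v) :
    DependsOn (blockCoeff F w C f x) C := by
  intro l l' h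
  refine Finset.expect_congr rfl fun y _ => ?_
  congr 1
  exact Finset.prod_congr rfl fun c hc => by rw [h c hc]

theorem blockCoeff_dependsOn_left {f : (∀ v, α v) → ℂ} {s : Finset V}
    (hf : DependsOn f ((s ∪ C.biUnion F : Finset V) : Set V)) (l : ∀ e, β e) :
    DependsOn (fun x => blockCoeff F w C f x l) s := by
  intro x x' h
  refine Finset.expect_congr rfl fun y _ => ?_
  congr 1
  refine hf fun v hv => ?_
  by_cases hv' : v ∈ C.biUnion F
  · simp only [Finset.piecewise_eq_of_mem _ _ _ hv']
  · simp only [Finset.piecewise_eq_of_notMem _ _ _ hv']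
    refine h v ?_
    rw [Finset.mem_coe, Finset.mem_union] at hv
    exact hv.resolve_right hv'

/-- The projections on the disjoint blocks all fix `f`, so they can be applied one after the other.
-/
theorem expect_expect_blocks (hF : (C : Set E).PairwiseDisjoint F)
    (hw : ∀ c ∈ C, ∀ t, DependsOn (w c t) (F c)) {f : (∀ v, α v) → ℂ}
    (hf : ∀ c ∈ C, FixedBy (F c) (w c) f) (x : ∀ v, α v) :
    f x = 𝔼 l : (∀ e, β e), 𝔼 y, (∏ c ∈ C, w c (l c) x * star (w c (l c) y)) *
      f ((C.biUnion F).piecewise y x) := by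
  induction C using Finset.induction_on with
  | empty =>
    have h : ∀ y, ((∅ : Finset E).biUnion F).piecewise y x = x := fun y => by
      ext v; exact Finset.piecewise_eq_of_notMem _ _ _ (by simp)
    simp only [h]
    simp
  | insert a C ha ih =>
    have hd : Disjoint (F a) (C.biUnion F) := by
      rw [Finset.disjoint_biUnion_right]
      intro j hj
      exact hF (by simp) (by simp [hj]) (by rintro rfl; exact ha hj)
    rw [ih (hF.subset (by simp)) (fun c hc => hw c (by simp [hc]))
      (fun c hc => hf c (by simp [hc]))]
    symm
    -- The joint averages are split by resampling: the label of `a` and the point on `F a` become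
    -- independent of the rest.
    rw [← expect_expect_piecewise {a}]
    refine Finset.expect_congr rfl fun l _ => ?_
    rw [Finset.expect_congr rfl fun l' _ => (expect_expect_piecewise (F a) _).symm,
      Finset.expect_comm]
    refine Finset.expect_congr rfl fun y _ => ?_
    symm
    rw [hf a (by simp), ← expect_apply_coord a fun t => 𝔼 y', w a t ((C.biUnion F).piecewise y x) *
      star (w a t y') * f ((F a).piecewise y' ((C.biUnion F).piecewise y x)), Finset.mul_expect]
    refine Finset.expect_congr rfl fun l' _ => ?_
    rw [Finset.mul_expect]
    refine Finset.expect_congr rfl fun y' _ => ?_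
    rw [Finset.prod_insert ha]
    have h1 : w a (l' a) ((C.biUnion F).piecewise y x) = w a (l' a) x :=
      hw a (by simp) _ fun v hv => Finset.piecewise_eq_of_notMem _ _ _
        (Finset.disjoint_left.1 hd hv)
    have h2 : w a (l' a) ((F a).piecewise y' y) = w a (l' a) y' :=
      hw a (by simp) _ fun v hv => Finset.piecewise_eq_of_mem _ _ _ hv
    have h3 : ∀ c ∈ C, w c (({a} : Finset E).piecewise l' l c) x *
        star (w c (({a} : Finset E).piecewise l' l c) ((F a).piecewise y' y)) =
        w c (l c) x * star (w c (l c) y) := by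
      intro c hc
      have hca : c ∉ ({a} : Finset E) := by
        rw [Finset.mem_singleton]; rintro rfl; exact ha hc
      rw [Finset.piecewise_eq_of_notMem _ _ _ hca]
      congr 2
      refine hw c (by simp [hc]) _ fun v hv => Finset.piecewise_eq_of_notMem _ _ _ fun hva => ?_
      exact Finset.disjoint_left.1 hd hva (Finset.mem_biUnion.2 ⟨c, hc, hv⟩)
    have h4 : ((insert a C).biUnion F).piecewise ((F a).piecewise y' y) x =
        (F a).piecewise y' ((C.biUnion F).piecewise y x) := by
      ext v
      rw [Finset.biUnion_insert]
      by_cases hv : v ∈ F a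
      · rw [Finset.piecewise_eq_of_mem _ _ _ (Finset.mem_union_left _ hv),
          Finset.piecewise_eq_of_mem _ _ _ hv, Finset.piecewise_eq_of_mem _ _ _ hv]
      · by_cases hv' : v ∈ C.biUnion F
        · rw [Finset.piecewise_eq_of_mem _ _ _ (Finset.mem_union_right _ hv'),
            Finset.piecewise_eq_of_notMem _ _ _ hv, Finset.piecewise_eq_of_notMem _ _ _ hv,
            Finset.piecewise_eq_of_mem _ _ _ hv']
        · rw [Finset.piecewise_eq_of_notMem _ _ _ (by simp only [Finset.mem_union]; tauto),
            Finset.piecewise_eq_of_notMem _ _ _ hv, Finset.piecewise_eq_of_notMem _ _ _ hv']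
    rw [Finset.prod_congr rfl h3, h4, Finset.piecewise_eq_of_mem _ _ _ (Finset.mem_singleton_self a),
      h1, h2]
    ring

theorem eq_expect_blockCoeff (hF : (C : Set E).PairwiseDisjoint F)
    (hw : ∀ c ∈ C, ∀ t, DependsOn (w c t) (F c)) {f : (∀ v, α v) → ℂ}
    (hf : ∀ c ∈ C, FixedBy (F c) (w c) f) (x : ∀ v, α v) :
    f x = 𝔼 l, blockCoeff F w C f x l * ∏ c ∈ C, w c (l c) x := by
  conv_lhs => rw [expect_expect_blocks hF hw hf x]
  refine Finset.expect_congr rfl fun l _ => ?_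
  rw [blockCoeff, Finset.expect_mul]
  refine Finset.expect_congr rfl fun y _ => ?_
  rw [Finset.prod_mul_distrib]
  ring

theorem expect_prod_ite (C : Finset E) (l : ∀ e, β e) :
    𝔼 l' : (∀ e, β e), ∏ c ∈ C, (if l c = l' c then (Fintype.card (β c) : ℂ) else 0) = 1 := by
  rw [expect_prod_of_dependsOn C (fun c => {c})]
  · refine Finset.prod_eq_one fun c _ => ?_
    rw [expect_apply_coord c fun t => if l c = t then (Fintype.card (β c) : ℂ) else 0]
    rw [Fintype.expect_eq_sum_div_card, Finset.sum_ite_eq]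
    simp
  · intro a _ b _ hab
    simpa using hab
  · intro c _ l₁ l₂ h
    simp only
    rw [h c (by simp)]

/-- Parseval's identity: on disjoint blocks the products of the block vectors are orthogonal, so
only terms whose labels agree on `C` survive. -/
theorem expect_star_mul_eq (hF : (C : Set E).PairwiseDisjoint F)
    (hw : ∀ c ∈ C, ∀ t, DependsOn (w c t) (F c))
    (ho : ∀ c ∈ C, ∀ t t', 𝔼 x, star (w c t x) * w c t' x =
      if t = t' then (Fintype.card (β c) : ℂ) else 0)
    {f g : (∀ v, α v) → ℂ} (hf : ∀ c ∈ C, FixedBy (F c) (w c) f)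
    (hg : ∀ c ∈ C, FixedBy (F c) (w c) g) {s : Finset V} (hs : Disjoint s (C.biUnion F))
    (hfs : DependsOn f ((s ∪ C.biUnion F : Finset V) : Set V))
    (hgs : DependsOn g ((s ∪ C.biUnion F : Finset V) : Set V)) :
    𝔼 x, star (f x) * g x =
      𝔼 l, 𝔼 x, star (blockCoeff F w C f x l) * blockCoeff F w C g x l := by
  have h1 : ∀ x, star (f x) * g x = 𝔼 l, 𝔼 l',
      (star (blockCoeff F w C f x l) * blockCoeff F w C g x l') *
        ∏ c ∈ C, (star (w c (l c) x) * w c (l' c) x) := by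
    intro x
    conv_lhs => rw [eq_expect_blockCoeff hF hw hf x, eq_expect_blockCoeff hF hw hg x]
    rw [star_expect, Fintype.expect_mul_expect]
    refine Finset.expect_congr rfl fun l _ => Finset.expect_congr rfl fun l' _ => ?_
    rw [star_mul', star_prod, Finset.prod_mul_distrib]
    ring
  simp only [h1]
  rw [Finset.expect_comm]
  refine Finset.expect_congr rfl fun l _ => ?_
  rw [Finset.expect_comm]
  have h2 : ∀ l', 𝔼 x, (star (blockCoeff F w C f x l) * blockCoeff F w C g x l') *
        ∏ c ∈ C, (star (w c (l c) x) * w c (l' c) x) =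
      (𝔼 x, star (blockCoeff F w C f x l) * blockCoeff F w C g x l) *
        ∏ c ∈ C, (if l c = l' c then (Fintype.card (β c) : ℂ) else 0) := by
    intro l'
    have hdep : ∀ c ∈ C, DependsOn (fun x => star (w c (l c) x) * w c (l' c) x) (F c) := by
      intro c hc x x' h
      simp only
      rw [hw c hc _ h, hw c hc _ h]
    have hdep' : DependsOn (fun x => star (blockCoeff F w C f x l) * blockCoeff F w C g x l') s := by
      intro x x' h
      have e1 := blockCoeff_dependsOn_left (w := w) hfs l h
      have e2 := blockCoeff_dependsOn_left (w := w) hgs l' h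
      simp only at e1 e2 ⊢
      rw [e1, e2]
    rw [expect_mul_of_dependsOn hs hdep', expect_prod_of_dependsOn C F hF hdep,
      Finset.prod_congr rfl fun c hc => ho c hc _ _]
    · by_cases hl : ∀ c ∈ C, l c = l' c
      · congr 1
        refine Finset.expect_congr rfl fun x _ => ?_
        rw [blockCoeff_dependsOn_right g x hl]
      · push Not at hl
        obtain ⟨c, hc, hne⟩ := hl
        rw [Finset.prod_eq_zero hc (by rw [if_neg hne]), mul_zero, mul_zero]
    · refine DependsOn.finset_prod C fun c hc => (hdep c hc).mono ?_
      exact_mod_cast Finset.subset_biUnion_of_mem F hc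
  simp only [h2]
  rw [← Finset.mul_expect, expect_prod_ite, mul_one]

end LocalTensor

/-! ### The canonical tree tensor network of a state -/

section TreeTensorNetwork

variable {V : Type} [Fintype V] [DecidableEq V] {G : SimpleGraph V} [DecidableRel G.Adj] {r : V}
  {α : V → Type} [∀ v, Fintype (α v)] [∀ v, DecidableEq (α v)] [∀ v, Nonempty (α v)]
  {β : G.edgeSet → Type} [∀ e, Fintype (β e)] [∀ e, Nonempty (β e)] [∀ e, DecidableEq (β e)]

variable (r) in
/-- The edges from `v` to its parent: one edge, or none at the root. -/
noncomputable def parentEdges (v : V) : Finset G.edgeSet :=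
  {e | v ∈ (e : Sym2 V) ∧ v ∈ farSide G r e}

theorem mem_parentEdges {v : V} {e : G.edgeSet} :
    e ∈ parentEdges r v ↔ v ∈ (e : Sym2 V) ∧ v ∈ farSide G r e := by
  simp [parentEdges]

variable (r) in
/-- The amplitude of the branch at `v`: the state `ψ` itself at the root, and the Schmidt vector
of the edge to the parent at any other vertex. -/
noncomputable def branchAmplitude (ψ : (∀ v, α v) → ℂ) (w : ∀ e, β e → (∀ v, α v) → ℂ) (v : V)
    (l : ∀ e, β e) (x : ∀ v, α v) : ℂ :=
  if v = r then ψ x else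
    -- On a tree this product has a single factor; writing a product avoids choosing the parent
    -- edge.
    ∏ e ∈ parentEdges r v, w e (l e) x

theorem branchAmplitude_root (ψ : (∀ v, α v) → ℂ) (w : ∀ e, β e → (∀ v, α v) → ℂ)
    (l : ∀ e, β e) : branchAmplitude r ψ w r l = ψ := by
  ext x; simp [branchAmplitude]

theorem IsParentEdge.branchAmplitude_eq (hG : G.IsTree) (ψ : (∀ v, α v) → ℂ)
    (w : ∀ e, β e → (∀ v, α v) → ℂ) {u v : V} {e : G.edgeSet} (h : IsParentEdge r u v e)
    (l : ∀ e, β e) : branchAmplitude r ψ w v l = w e (l e) := by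
  ext x
  have hv : v ≠ r := by rintro rfl; exact root_notMem_farSide v e h.2.2
  have hs : parentEdges r v = {e} := by
    ext f
    rw [mem_parentEdges, Finset.mem_singleton]
    constructor
    · rintro ⟨h1, h2⟩; exact parent_edge_unique hG h1 h2 h.right_mem h.2.2
    · rintro rfl; exact ⟨h.right_mem, h.2.2⟩
  rw [branchAmplitude, if_neg hv, hs, Finset.prod_singleton]

theorem branchAmplitude_dependsOn_label (ψ : (∀ v, α v) → ℂ)
    (w : ∀ e, β e → (∀ v, α v) → ℂ) (v : V) {l l' : ∀ e, β e}
    (h : ∀ e : G.edgeSet, v ∈ (e : Sym2 V) → v ∈ farSide G r e → l e = l' e) :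
    branchAmplitude r ψ w v l = branchAmplitude r ψ w v l' := by
  ext x
  rw [branchAmplitude, branchAmplitude]
  congr 1
  refine Finset.prod_congr rfl fun e he => ?_
  rw [mem_parentEdges] at he
  rw [h e he.1 he.2]

variable {ψ : (∀ v, α v) → ℂ} {w : ∀ e, β e → (∀ v, α v) → ℂ}

theorem eq_root_or_exists_isParentEdge (hG : G.IsTree) (v : V) :
    v = r ∨ ∃ u e, IsParentEdge (G := G) r u v e := by
  rcases eq_or_ne v r with h | h
  · exact .inl h
  · exact .inr (exists_isParentEdge r hG h)

theorem branchAmplitude_dependsOn (hG : G.IsTree)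
    (hw : ∀ e, IsSchmidtFamily ψ (farSide G r e) (w e)) (v : V) (l : ∀ e, β e) :
    DependsOn (branchAmplitude r ψ w v l) (descendants (G := G) r v) := by
  rcases eq_root_or_exists_isParentEdge (r := r) hG v with rfl | ⟨u, e, h⟩
  · intro x y hxy
    rw [show x = y from funext fun i => hxy i (mem_descendants_root hG i)]
  · rw [h.branchAmplitude_eq hG, ← h.farSide_eq hG]
    exact (hw e).dependsOn _

/-- The far side of a child edge lies inside that of the parent edge, so `IsSchmidtFamily.fixedBy`
applies. This nesting makes the local expansion possible. -/
theorem branchAmplitude_fixedBy (hG : G.IsTree)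
    (hw : ∀ e, IsSchmidtFamily ψ (farSide G r e) (w e)) (v : V) (l : ∀ e, β e) {c : G.edgeSet}
    (hc : c ∈ childEdges r v) : FixedBy (farSide G r c) (w c) (branchAmplitude r ψ w v l) := by
  rcases eq_root_or_exists_isParentEdge (r := r) hG v with rfl | ⟨u, e, h⟩
  · rw [branchAmplitude_root]; exact (hw c).fixed
  · rw [h.branchAmplitude_eq hG]
    refine (hw c).fixedBy (hw e) ?_ _
    rw [h.farSide_eq hG]
    exact (Finset.subset_biUnion_of_mem _ hc).trans (Finset.subset_insert _ _)

variable (r ψ w) in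
/-- The tensor at the vertex `v` in the canonical tree tensor network of `ψ`. -/
noncomputable def vertexTensor (v : V) (x : ∀ v, α v) (l : ∀ e, β e) : ℂ :=
  blockCoeff (farSide G r) w (childEdges r v) (branchAmplitude r ψ w v l) x l

theorem vertexTensor_dependsOn_coord (hG : G.IsTree)
    (hw : ∀ e, IsSchmidtFamily ψ (farSide G r e) (w e)) (v : V) (l : ∀ e, β e) :
    DependsOn (fun x => vertexTensor r ψ w v x l) {v} := by
  have := blockCoeff_dependsOn_left (F := farSide G r) (w := w) (C := childEdges r v) (s := {v})
    (f := branchAmplitude r ψ w v l) (by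
      rw [← Finset.insert_eq]; exact branchAmplitude_dependsOn hG hw v l) l
  rw [Finset.coe_singleton] at this
  exact this

theorem vertexTensor_dependsOn_label (v : V) (x : ∀ v, α v) :
    DependsOn (vertexTensor r ψ w v x) {e | v ∈ (e : Sym2 V)} := by
  intro l l' h
  rw [vertexTensor, vertexTensor,
    branchAmplitude_dependsOn_label ψ w v (l := l) (l' := l') fun e he _ => h e he]
  exact blockCoeff_dependsOn_right _ _ fun c hc => h c (mem_childEdges.1 hc).1

theorem branchAmplitude_eq_expect (hG : G.IsTree)
    (hw : ∀ e, IsSchmidtFamily ψ (farSide G r e) (w e)) (v : V) (l : ∀ e, β e) (x : ∀ v, α v) :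
    branchAmplitude r ψ w v l x = 𝔼 l', vertexTensor r ψ w v x ((childEdges r v).piecewise l' l) *
      ∏ c ∈ childEdges r v, w c (l' c) x := by
  rw [eq_expect_blockCoeff (F := farSide G r) (w := w) (farSide_disjoint hG v)
    (fun c _ => (hw c).dependsOn) (fun c hc => branchAmplitude_fixedBy hG hw v l hc) x]
  refine Finset.expect_congr rfl fun l' _ => ?_
  congr 1
  rw [vertexTensor, branchAmplitude_dependsOn_label ψ w v
    (l := (childEdges r v).piecewise l' l) (l' := l)]
  · refine blockCoeff_dependsOn_right _ _ fun c hc => ?_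
    rw [Finset.piecewise_eq_of_mem _ _ _ hc]
  · intro e h1 h2
    rw [Finset.piecewise_eq_of_notMem]
    rw [mem_childEdges]
    exact fun h => h.2 h2

/-- Parseval turns the contraction over child edges and the local system into an inner product of
branch amplitudes. Below the root these are orthonormal Schmidt vectors; at the root there is no
parent label, and `κ` is the mean of `‖ψ x‖ ^ 2`. -/
theorem vertexTensor_isometry (hG : G.IsTree) (hψ : ψ ≠ 0)
    (hw : ∀ e, IsSchmidtFamily ψ (farSide G r e) (w e)) (v : V) :
    ∃ κ : ℝ, 0 < κ ∧ ∀ l l' : ∀ e, β e,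
      𝔼 k, 𝔼 x, star (vertexTensor r ψ w v x ((childEdges r v).piecewise k l)) *
        vertexTensor r ψ w v x ((childEdges r v).piecewise k l') =
      if ∀ e : G.edgeSet, v ∈ (e : Sym2 V) → v ∈ farSide G r e → l e = l' e then (κ : ℂ) else 0 := by
  have key : ∀ l l' : ∀ e, β e,
      𝔼 k, 𝔼 x, star (vertexTensor r ψ w v x ((childEdges r v).piecewise k l)) *
        vertexTensor r ψ w v x ((childEdges r v).piecewise k l') =
      𝔼 x, star (branchAmplitude r ψ w v l x) * branchAmplitude r ψ w v l' x := by
    intro l l'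
    rw [expect_star_mul_eq (F := farSide G r) (w := w) (farSide_disjoint hG v)
      (fun c _ => (hw c).dependsOn) (fun c _ => (hw c).orthonormal)
      (fun c hc => branchAmplitude_fixedBy hG hw v l hc)
      (fun c hc => branchAmplitude_fixedBy hG hw v l' hc) (s := {v}) ?_
      (by rw [← Finset.insert_eq]; exact branchAmplitude_dependsOn hG hw v l)
      (by rw [← Finset.insert_eq]; exact branchAmplitude_dependsOn hG hw v l')]
    · have h : ∀ (k l : ∀ e, β e) x, vertexTensor r ψ w v x ((childEdges r v).piecewise k l) =
          blockCoeff (farSide G r) w (childEdges r v) (branchAmplitude r ψ w v l) x k := by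
        intro k l x
        rw [vertexTensor, branchAmplitude_dependsOn_label ψ w v
          (l := (childEdges r v).piecewise k l) (l' := l)]
        · refine blockCoeff_dependsOn_right _ _ fun c hc => ?_
          rw [Finset.piecewise_eq_of_mem _ _ _ hc]
        · intro e h1 h2
          rw [Finset.piecewise_eq_of_notMem]
          rw [mem_childEdges]
          exact fun h => h.2 h2
      simp only [h]
    · rw [Finset.disjoint_singleton_left, Finset.mem_biUnion]
      rintro ⟨c, hc, hv⟩
      exact (mem_childEdges.1 hc).2 hv
  simp only [key]
  rcases eq_root_or_exists_isParentEdge (r := r) hG v with rfl | ⟨u, e, h⟩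
  · refine ⟨𝔼 x, ‖ψ x‖ ^ 2, ?_, fun l l' => ?_⟩
    · obtain ⟨x, hx⟩ := Function.ne_iff.1 hψ
      refine lt_of_lt_of_le ?_ (Fintype.expect_eq_sum_div_card (K := ℝ) _).ge
      refine div_pos (Finset.sum_pos' (fun _ _ => by positivity) ⟨x, Finset.mem_univ _, ?_⟩) ?_
      · have : 0 < ‖ψ x‖ := norm_pos_iff.2 hx
        positivity
      · exact_mod_cast Fintype.card_pos
    · rw [if_pos fun e _ h => absurd h (root_notMem_farSide v e), branchAmplitude_root,
        branchAmplitude_root, Fintype.expect_eq_sum_div_card, Fintype.expect_eq_sum_div_card]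
      push_cast
      congr 1
      refine Finset.sum_congr rfl fun x _ => ?_
      rw [RCLike.star_def, ← Complex.conj_mul']
  · refine ⟨Fintype.card (β e), by exact_mod_cast Fintype.card_pos, fun l l' => ?_⟩
    rw [h.branchAmplitude_eq hG, h.branchAmplitude_eq hG, (hw e).orthonormal]
    refine if_congr ⟨?_, fun hl => hl e h.right_mem h.2.2⟩ (by simp) rfl
    intro hl f h1 h2
    obtain rfl := parent_edge_unique hG h1 h2 h.right_mem h.2.2
    exact hl

open Classical in
variable (G r) in
/-- The edges that lead from a set of vertices down to its complement. -/
noncomputable def downBoundary (S : Finset V) : Finset G.edgeSet :=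
  {e | ∃ u w, IsParentEdge r u w e ∧ u ∈ S ∧ w ∉ S}

theorem IsParentEdge.mem_downBoundary {u w : V} {e : G.edgeSet} (h : IsParentEdge r u w e)
    {S : Finset V} : e ∈ downBoundary G r S ↔ u ∈ S ∧ w ∉ S := by
  simp only [downBoundary, Finset.mem_filter, Finset.mem_univ, true_and]
  constructor
  · rintro ⟨u', w', h', h1, h2⟩
    rw [← h'.eq_left h.left_mem h.2.1, ← h'.eq_right h.right_mem h.2.2] at *
    exact ⟨h1, h2⟩
  · exact fun h' => ⟨u, w, h, h'⟩

/-- The network is grown from the root: adding a vertex replaces the Schmidt vector of its parent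
edge by its tensor times the Schmidt vectors of its child edges. -/
theorem eq_expect_prod_vertexTensor (hG : G.IsTree)
    (hw : ∀ e, IsSchmidtFamily ψ (farSide G r e) (w e)) (x : ∀ v, α v) :
    ψ x = 𝔼 l, ∏ v, vertexTensor r ψ w v x l := by
  have key : ∀ S : Finset V, ParentClosed G r S → S.Nonempty →
      ψ x = 𝔼 l, (∏ v ∈ S, vertexTensor r ψ w v x l) * ∏ e ∈ downBoundary G r S, w e (l e) x := by
    intro S hS
    refine parentClosed_induction (G := G) (r := r) (motive := fun S => S.Nonempty →
      ψ x = 𝔼 l, (∏ v ∈ S, vertexTensor r ψ w v x l) * ∏ e ∈ downBoundary G r S, w e (l e) x)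
      ?_ ?_ S hS
    · intro h; simp at h
    · intro v S hvS hS hS' hchild ih _
      have hsplit : downBoundary G r (insert v S) =
          (downBoundary G r S).filter (fun e : G.edgeSet => v ∉ (e : Sym2 V)) ∪ childEdges r v := by
        ext e
        obtain ⟨a, b, hab⟩ := exists_isParentEdge_of_edge r hG e
        rw [Finset.mem_union, Finset.mem_filter, hab.mem_downBoundary, hab.mem_downBoundary,
          hab.mem_childEdges_iff, hab.1, Sym2.mem_iff]
        simp only [Finset.mem_insert, not_or]
        constructor
        · rintro ⟨rfl | h1, h2, h3⟩
          · exact .inr rfl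
          · exact .inl ⟨⟨h1, h3⟩, by rintro rfl; exact hvS h1, fun h => h2 h.symm⟩
        · rintro (⟨⟨h1, h2⟩, h3, h4⟩ | rfl)
          · exact ⟨.inr h1, fun h => h4 h.symm, h2⟩
          · refine ⟨.inl rfl, ?_, hchild _ _ hab⟩
            rintro rfl; exact hab.2.1 hab.2.2
      have hdisj : Disjoint ((downBoundary G r S).filter (fun e : G.edgeSet => v ∉ (e : Sym2 V)))
          (childEdges r v) := by
        rw [Finset.disjoint_left]
        intro e he he'
        exact (Finset.mem_filter.1 he).2 (mem_childEdges.1 he').1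
      -- The factor to be expanded is isolated. If `S` is empty, then `v` is the root and the factor
      -- is `ψ`; otherwise it is the Schmidt vector of the parent edge, which lies in the boundary
      -- of `S`.
      have hold : ψ x = 𝔼 l, (∏ u ∈ S, vertexTensor r ψ w u x l) *
          (∏ e ∈ (downBoundary G r S).filter (fun e : G.edgeSet => v ∉ (e : Sym2 V)), w e (l e) x) *
          branchAmplitude r ψ w v l x := by
        rcases S.eq_empty_or_nonempty with rfl | hne
        · have hv : v = r := by
            by_contra hv
            obtain ⟨u, e, h⟩ := exists_isParentEdge (G := G) r hG hv
            have := hS' u v e h (by simp)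
            simp only [insert_empty_eq, Finset.mem_singleton] at this
            subst this
            exact h.2.1 h.2.2
          subst hv
          have : downBoundary G v (∅ : Finset V) = ∅ := by simp [downBoundary]
          simp [this, branchAmplitude_root]
        · have hr : r ∈ S := by
            obtain ⟨y, hy⟩ := hne
            have : ∀ y, y ∈ S → r ∈ S := fun y => tree_induction (G := G) r hG
              (motive := fun y => y ∈ S → r ∈ S) id
              (fun u w e h ih hw => ih (hS u w e h hw)) y
            exact this y hy
          have hv : v ≠ r := by rintro rfl; exact hvS hr
          obtain ⟨u, e, h⟩ := exists_isParentEdge (G := G) r hG hv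
          have hu : u ∈ S := by
            have := hS' u v e h (by simp)
            rcases Finset.mem_insert.1 this with rfl | h'
            · exact absurd h.2.2 h.2.1
            · exact h'
          have he : e ∈ downBoundary G r S := h.mem_downBoundary.2 ⟨hu, hvS⟩
          have hf : (downBoundary G r S).filter (fun e : G.edgeSet => v ∉ (e : Sym2 V)) =
              (downBoundary G r S).erase e := by
            ext f
            rw [Finset.mem_filter, Finset.mem_erase, and_comm]
            refine and_congr_left fun hf => ?_
            rw [not_iff_comm, not_not]
            constructor
            · rintro rfl; exact h.right_mem
            · intro hvf
              obtain ⟨a, b, hab⟩ := exists_isParentEdge_of_edge r hG f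
              rw [hab.mem_downBoundary] at hf
              have : v = b := (hab.eq_or_eq hvf).resolve_left (by rintro rfl; exact hvS hf.1)
              subst this
              exact parent_edge_unique hG hvf hab.2.2 h.right_mem h.2.2
          rw [ih hne, hf]
          refine Finset.expect_congr rfl fun l _ => ?_
          rw [h.branchAmplitude_eq hG, mul_assoc, Finset.prod_erase_mul _ _ he]
      rw [hold, hsplit]
      symm
      -- The child labels enter only the new tensor and the new Schmidt vectors, so they can be
      -- averaged separately.
      rw [← expect_expect_piecewise (childEdges r v)]
      refine Finset.expect_congr rfl fun l _ => ?_
      symm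
      rw [branchAmplitude_eq_expect hG hw, Finset.mul_expect]
      refine Finset.expect_congr rfl fun l' _ => ?_
      rw [Finset.prod_insert hvS, Finset.prod_union hdisj]
      have h1 : ∀ u ∈ S, vertexTensor r ψ w u x ((childEdges r v).piecewise l' l) =
          vertexTensor r ψ w u x l := by
        intro u hu
        refine vertexTensor_dependsOn_label u x fun e he => ?_
        rw [Finset.piecewise_eq_of_notMem]
        intro hc
        obtain ⟨a, b, hab⟩ := exists_isParentEdge_of_edge r hG e
        obtain rfl := hab.mem_childEdges_iff.1 hc
        rcases hab.eq_or_eq he with rfl | rfl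
        · exact hvS hu
        · exact hchild _ _ hab hu
      have h2 : ∀ e ∈ (downBoundary G r S).filter (fun e : G.edgeSet => v ∉ (e : Sym2 V)),
          w e ((childEdges r v).piecewise l' l e) x = w e (l e) x := by
        intro e he
        rw [Finset.piecewise_eq_of_notMem _ _ _ (Finset.disjoint_left.1 hdisj he)]
      have h3 : ∀ c ∈ childEdges r v,
          w c ((childEdges r v).piecewise l' l c) x = w c (l' c) x := by
        intro c hc
        rw [Finset.piecewise_eq_of_mem _ _ _ hc]
      rw [Finset.prod_congr rfl h1, Finset.prod_congr rfl h2, Finset.prod_congr rfl h3]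
      ring
  have h := key Finset.univ (fun _ _ _ _ _ => Finset.mem_univ _) ⟨r, Finset.mem_univ r⟩
  have hb : downBoundary G r (Finset.univ : Finset V) = ∅ := by simp [downBoundary]
  simpa [hb] using h

end TreeTensorNetwork

/-! ### Product operators and pure states -/

section TensorOp

variable {V : Type} [Fintype V] [DecidableEq V] {D E F : V → LocalSystem}

theorem tensorOp_mul (A : ∀ v, Matrix (F v).Idx (E v).Idx ℂ) (B : ∀ v, Matrix (E v).Idx (D v).Idx ℂ) :
    tensorOp A * tensorOp B = tensorOp fun v => A v * B v := by
  ext x z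
  simp only [tensorOp, Matrix.mul_apply, Matrix.of_apply, ← Finset.prod_mul_distrib]
  exact (Fintype.prod_sum fun v j => A v (x v) j * B v j (z v)).symm

theorem tensorOp_conjTranspose (A : ∀ v, Matrix (E v).Idx (D v).Idx ℂ) :
    (tensorOp A)ᴴ = tensorOp fun v => (A v)ᴴ := by
  ext x z
  simp [tensorOp, Matrix.conjTranspose_apply]

theorem tensorOp_one : tensorOp (fun v => (1 : Matrix (D v).Idx (D v).Idx ℂ)) = 1 := by
  ext x z
  simp only [tensorOp, Matrix.of_apply, Matrix.one_apply, Finset.prod_ite_zero, Finset.mem_univ,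
    true_implies, Finset.prod_const_one, funext_iff]

theorem mul_pureState_mul_conjTranspose {I J : Type} [Fintype I] [Fintype J]
    (M : Matrix J I ℂ) (φ : I → ℂ) : M * pureState φ * Mᴴ = pureState (M *ᵥ φ) := by
  rw [pureState, pureState, Matrix.mul_vecMulVec, Matrix.vecMulVec_mul, Matrix.star_mulVec]

theorem pureState_smul {I : Type} (c : ℂ) (φ : I → ℂ) :
    pureState (c • φ) = (c * star c) • pureState φ := by
  ext x y
  simp [pureState, Matrix.vecMulVec]
  ring

theorem trace_pureState {I : Type} [Fintype I] (φ : I → ℂ) :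
    (pureState φ).trace = ∑ x, φ x * star (φ x) := by
  simp [pureState, Matrix.trace, Matrix.vecMulVec]

end TensorOp

/-! ### Kraus form and trace of LOCC channels -/

section LOCC

variable {V : Type} [Fintype V] [DecidableEq V] {T D : V → LocalSystem}

theorem sum_tensorOp_conjTranspose_mul {n : ℕ} {E : Fin n → V → LocalSystem} {v : V}
    {A : ∀ (j : Fin n) (w : V), Matrix (E j w).Idx (D w).Idx ℂ}
    (complete : ∑ j, (A j v)ᴴ * A j v = 1)
    (isometry : ∀ j w, w ≠ v → (A j w)ᴴ * A j w = 1) :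
    ∑ j, (tensorOp (A j))ᴴ * tensorOp (A j) = 1 := by
  simp only [tensorOp_conjTranspose, tensorOp_mul]
  rw [← tensorOp_one]
  ext x y
  simp only [Matrix.sum_apply, tensorOp, Matrix.of_apply]
  rw [← Finset.prod_erase_mul _ _ (Finset.mem_univ v), ← complete, Matrix.sum_apply, Finset.mul_sum]
  refine Finset.sum_congr rfl fun j _ => ?_
  rw [← Finset.prod_erase_mul _ _ (Finset.mem_univ v)]
  congr 1
  refine Finset.prod_congr rfl fun w hw => ?_
  rw [isometry j w (Finset.ne_of_mem_erase hw)]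

theorem LOCC.trace_channel (P : LOCC T D) (ρ : Matrix (Joint D) (Joint D) ℂ) :
    (P.channel ρ).trace = ρ.trace := by
  induction P with
  | done => rfl
  | round v n E A complete isometry next ih =>
    rw [LOCC.channel, Matrix.trace_sum]
    simp only [ih]
    have h : ∀ j, (tensorOp (A j) * ρ * (tensorOp (A j))ᴴ).trace =
        ((tensorOp (A j))ᴴ * tensorOp (A j) * ρ).trace := by
      intro j
      rw [Matrix.trace_mul_comm, Matrix.mul_assoc]
    simp only [h]
    rw [← Matrix.trace_sum, ← Finset.sum_mul, sum_tensorOp_conjTranspose_mul complete isometry,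
      one_mul]

/-- Kraus form of an LOCC channel. -/
theorem LOCC.exists_kraus (P : LOCC T D) :
    ∃ (J : Type) (_ : Fintype J) (K : J → ∀ v, Matrix (T v).Idx (D v).Idx ℂ),
      ∀ ρ, P.channel ρ = ∑ j, tensorOp (K j) * ρ * (tensorOp (K j))ᴴ := by
  induction P with
  | done =>
    refine ⟨Unit, inferInstance, fun _ v => 1, fun ρ => ?_⟩
    simp [LOCC.channel, tensorOp_one]
  | round v n E A complete isometry next ih =>
    choose J hJ K hK using ih
    refine ⟨Σ j, J j, inferInstance, fun p w => K p.1 p.2 w * A p.1 w, fun ρ => ?_⟩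
    rw [LOCC.channel, Fintype.sum_sigma]
    refine Finset.sum_congr rfl fun j _ => ?_
    rw [hK]
    refine Finset.sum_congr rfl fun i _ => ?_
    rw [← tensorOp_mul, Matrix.conjTranspose_mul]
    simp only [Matrix.mul_assoc]

/-- A pure state that is produced deterministically from a pure state is produced, up to a scalar,
by a product operator. -/
theorem LOCC.exists_tensorOp_mulVec (P : LOCC T D) {φ : Joint D → ℂ} {ψ : Joint T → ℂ}
    (hψ : ψ ≠ 0) (h : P.channel (pureState φ) = pureState ψ) :
    ∃ (K : ∀ v, Matrix (T v).Idx (D v).Idx ℂ) (c : ℂ), ψ = c • (tensorOp K *ᵥ φ) := by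
  obtain ⟨J, _, K, hK⟩ := P.exists_kraus
  set u : J → Joint T → ℂ := fun j => tensorOp (K j) *ᵥ φ with hu
  have hsum : ∀ a b, ∑ j, u j a * star (u j b) = ψ a * star (ψ b) := by
    intro a b
    have := congrFun (congrFun ((hK _).symm.trans h) a) b
    simp only [mul_pureState_mul_conjTranspose] at this
    simpa only [Matrix.sum_apply, pureState, Matrix.vecMulVec_apply,
      Pi.star_apply] using this
  have hpar : ∀ a b j, u j a * ψ b = u j b * ψ a := by
    intro a b
    -- Expanding with `hsum` gives zero for a sum of squared moduli. So all 2×2 minors of `u j`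
    -- against `ψ` vanish, and each branch is parallel to `ψ`.
    have h0 : ∑ j, (u j a * ψ b - u j b * ψ a) * star (u j a * ψ b - u j b * ψ a) = 0 := by
      have h1 : ∀ j, (u j a * ψ b - u j b * ψ a) * star (u j a * ψ b - u j b * ψ a) =
          u j a * star (u j a) * (ψ b * star (ψ b)) - u j a * star (u j b) * (ψ b * star (ψ a)) -
          u j b * star (u j a) * (ψ a * star (ψ b)) + u j b * star (u j b) * (ψ a * star (ψ a)) := by
        intro j; simp only [star_sub, star_mul']; ring
      simp only [h1, Finset.sum_add_distrib, Finset.sum_sub_distrib, ← Finset.sum_mul, hsum]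
      ring
    intro j
    have h2 : ∀ z : ℂ, z * star z = ((‖z‖ ^ 2 : ℝ) : ℂ) := fun z => by
      rw [RCLike.star_def, Complex.mul_conj']; push_cast; rfl
    simp only [h2] at h0
    rw [← Complex.ofReal_sum, Complex.ofReal_eq_zero,
      Finset.sum_eq_zero_iff_of_nonneg fun _ _ => by positivity] at h0
    have := h0 j (Finset.mem_univ j)
    rw [sq_eq_zero_iff, norm_eq_zero, sub_eq_zero] at this
    exact this
  obtain ⟨b, hb⟩ := Function.ne_iff.1 hψ
  have hb' : ψ b ≠ 0 := hb
  obtain ⟨j, hj⟩ : ∃ j, u j b ≠ 0 := by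
    by_contra hcon
    push Not at hcon
    have := hsum b b
    simp [hcon, hb'] at this
  refine ⟨K j, ψ b / u j b, ?_⟩
  ext a
  change ψ a = ψ b / u j b * u j a
  field_simp
  rw [mul_comm (ψ a), ← hpar a b j, mul_comm]

/-- As all outcomes yield the same unnormalized vector, one continuation serves them all, and the
sum over outcomes only counts them. -/
theorem LOCC.exists_round {E : V → LocalSystem} (v : V) {J : Type} [Fintype J]
    (A : J → ∀ w, Matrix (E w).Idx (D w).Idx ℂ)
    (complete : ∑ j, (A j v)ᴴ * A j v = 1)
    (isometry : ∀ j w, w ≠ v → (A j w)ᴴ * A j w = 1) {φ : Joint D → ℂ} {φ' : Joint E → ℂ}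
    (h : ∀ j, tensorOp (A j) *ᵥ φ = φ') (P : LOCC T E) :
    ∃ P' : LOCC T D, P'.channel (pureState φ) =
      (Fintype.card J : ℂ) • P.channel (pureState φ') := by
  let e := (Fintype.equivFin J).symm
  refine ⟨LOCC.round v (Fintype.card J) (fun _ => E) (fun i => A (e i))
    ((e.sum_comp fun j => (A j v)ᴴ * A j v).trans complete) (fun i => isometry (e i))
    (fun _ => P), ?_⟩
  rw [LOCC.channel]
  simp only [mul_pureState_mul_conjTranspose, h]
  simp [Nat.cast_smul_eq_nsmul]

end LOCC

/-! ### Monomial matrices -/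

section MonomialMatrix

variable {I : Type} [Fintype I] [DecidableEq I]

/-- The operator `|y⟩ ↦ θ y |f y⟩`. -/
def monomialMatrix (f : I → I) (θ : I → ℂ) : Matrix I I ℂ :=
  Matrix.of fun z y => if z = f y then θ y else 0

theorem mul_monomialMatrix {J : Type} (M : Matrix J I ℂ) (f : I → I) (θ : I → ℂ) (a : J) (y : I) :
    (M * monomialMatrix f θ) a y = M a (f y) * θ y := by
  simp [monomialMatrix, Matrix.mul_apply]

theorem monomialMatrix_isometry {f : I → I} (hf : Function.Injective f) {θ : I → ℂ}
    (hθ : ∀ y, star (θ y) * θ y = 1) : (monomialMatrix f θ)ᴴ * monomialMatrix f θ = 1 := by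
  ext y y'
  rw [mul_monomialMatrix, Matrix.conjTranspose_apply, Matrix.one_apply, monomialMatrix,
    Matrix.of_apply]
  by_cases h : y = y'
  · subst h; simp only [if_true]; exact hθ y
  · rw [if_neg h, if_neg fun h' => h (hf h').symm]; simp

theorem monomialMatrix_eq_one {f : I → I} (hf : ∀ y, f y = y) {θ : I → ℂ} (hθ : ∀ y, θ y = 1) :
    monomialMatrix f θ = 1 := by
  ext z y
  simp [monomialMatrix, hf, hθ, Matrix.one_apply]

end MonomialMatrix

/-! ### The resource state as a sum over edge labels -/

section Resource

variable {V : Type} [Fintype V] [DecidableEq V] {G : SimpleGraph V} [DecidableRel G.Adj]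
  {m : G.edgeSet → ℕ+}

/-- The basis state of the party `v` in which the edge `e` carries the label `l e`. -/
def localLabel (l : ∀ e : G.edgeSet, Fin (m e)) (v : V) : (resourceSystem G m v).Idx :=
  fun e => l e.1

/-- The extension by zero of a basis state of the party `v`. -/
def extendLabel {v : V} (y : (resourceSystem G m v).Idx) (e : G.edgeSet) : Fin (m e) :=
  if h : v ∈ (e : Sym2 V) then y ⟨e, h⟩ else 0

theorem extendLabel_of_mem {v : V} (y : (resourceSystem G m v).Idx) {e : G.edgeSet}
    (h : v ∈ (e : Sym2 V)) : extendLabel y e = y ⟨e, h⟩ := dif_pos h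

theorem extendLabel_localLabel (l : ∀ e : G.edgeSet, Fin (m e)) {v : V} {e : G.edgeSet}
    (h : v ∈ (e : Sym2 V)) : extendLabel (localLabel l v) e = l e := dif_pos h

-- The resource state has constant amplitude on its support, which consists of the basis states
-- whose labels agree at both ends of every edge, that is, of the image of `localLabel`.
variable (m) in
theorem sum_resourceState_mul (g : Joint (resourceSystem G m) → ℂ) :
    ∑ x, resourceState G m x * g x =
      (∏ e : G.edgeSet, ((1 / √(m e : ℝ) : ℝ) : ℂ)) *
        ∑ l : ∀ e : G.edgeSet, Fin (m e), g (localLabel l) := by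
  rw [Finset.mul_sum]
  symm
  refine Fintype.sum_of_injective (fun l : ∀ e : G.edgeSet, Fin (m e) => localLabel l) ?_ _ _ ?_ ?_
  · intro l l' h
    ext1 e
    have := congrFun (congrFun h (e : Sym2 V).out.1) ⟨e, Sym2.out_fst_mem _⟩
    exact this
  · intro x hx
    rw [mul_eq_zero]
    left
    by_contra hne
    rw [resourceState] at hne
    replace hne := Finset.prod_ne_zero_iff.1 hne
    refine hx ⟨fun e => x (e : Sym2 V).out.1 ⟨e, Sym2.out_fst_mem _⟩, ?_⟩
    ext1 v
    ext1 e
    have h := hne e.1 (Finset.mem_univ _)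
    rw [ite_ne_right_iff] at h
    exact h.1 _ _ _ _
  · intro l
    congr 1
    rw [resourceState]
    refine Finset.prod_congr rfl fun e _ => ?_
    rw [if_pos]
    intros
    rfl

theorem tensorOp_mulVec_resourceState {T : V → LocalSystem}
    (A : ∀ v, Matrix (T v).Idx (resourceSystem G m v).Idx ℂ) (x : Joint T) :
    (tensorOp A *ᵥ resourceState G m) x =
      (∏ e : G.edgeSet, ((1 / √(m e : ℝ) : ℝ) : ℂ)) *
        ∑ l : ∀ e : G.edgeSet, Fin (m e), ∏ v, A v (x v) (localLabel l v) := by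
  rw [← sum_resourceState_mul m fun y => ∏ v, A v (x v) (y v)]
  simp only [Matrix.mulVec, dotProduct, tensorOp, Matrix.of_apply, mul_comm]

variable (m) in
theorem trace_pureState_resourceState : (pureState (resourceState G m)).trace = 1 := by
  rw [trace_pureState, sum_resourceState_mul m fun x => star (resourceState G m x)]
  have h : ∀ l : ∀ e : G.edgeSet, Fin (m e), resourceState G m (localLabel l) =
      ∏ e : G.edgeSet, ((1 / √(m e : ℝ) : ℝ) : ℂ) := by
    intro l
    rw [resourceState]
    refine Finset.prod_congr rfl fun e _ => ?_
    rw [if_pos]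
    intros
    rfl
  simp only [h]
  rw [Finset.sum_const, Finset.card_univ, Fintype.card_pi, star_prod, nsmul_eq_mul]
  push_cast
  rw [← mul_assoc, mul_right_comm, ← Finset.prod_mul_distrib, ← Finset.prod_mul_distrib]
  refine Finset.prod_eq_one fun e _ => ?_
  have h0 : (0 : ℝ) < (m e : ℝ) := by exact_mod_cast (m e).pos
  have h1 : (√(m e : ℝ) : ℂ) * (√(m e : ℝ) : ℂ) = (m e : ℂ) := by
    rw [← Complex.ofReal_mul, Real.mul_self_sqrt h0.le]; simp
  have h2 : (√(m e : ℝ) : ℂ) ≠ 0 := by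
    rw [Ne, Complex.ofReal_eq_zero]; exact (Real.sqrt_pos.2 h0).ne'
  simp only [Fintype.card_fin]
  rw [star_div₀, star_one, RCLike.star_def, Complex.conj_ofReal, ← h1]
  field_simp

end Resource

/-! ### Pauli operators that fix the resource state -/

section Pauli

variable {V : Type} [Fintype V] [DecidableEq V] {G : SimpleGraph V} [DecidableRel G.Adj]
  {m : G.edgeSet → ℕ+} (r : V)

/-- The phases of the generalized Pauli operators on the edges from `v` to its children. -/
noncomputable def pauliPhase (v : V) (χ : AddChar (∀ e : G.edgeSet, Fin (m e)) ℂ) (w : V)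
    (z : ∀ e : G.edgeSet, Fin (m e)) : ℂ :=
  ∏ e ∈ childEdges r v, if w ∈ (e : Sym2 V) then
    (if w = v then χ (Pi.single e (z e)) else χ (-Pi.single e (z e))) else 1

/-- Generalized Pauli operators on the edges from `v` to its children: the operator of the party
`v` for `w = v`, and the corresponding corrections at the other ends of the edges. -/
noncomputable def pauliOp (v : V) (s : ∀ e : G.edgeSet, Fin (m e))
    (χ : AddChar (∀ e : G.edgeSet, Fin (m e)) ℂ) (w : V) :
    Matrix (resourceSystem G m w).Idx (resourceSystem G m w).Idx ℂ :=
  monomialMatrix (fun y e => y e + (childEdges r v).piecewise s 0 e.1)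
    fun y => pauliPhase r v χ w (extendLabel y)

variable {r}

theorem addChar_star_mul_self {A : Type} [AddCommGroup A] [Finite A] (χ : AddChar A ℂ) (a : A) :
    star (χ a) * χ a = 1 := by
  rw [RCLike.star_def, ← AddChar.map_neg_eq_conj, ← AddChar.map_add_eq_mul, neg_add_cancel,
    AddChar.map_zero_eq_one]

theorem pauliPhase_congr {v : V} (χ : AddChar (∀ e : G.edgeSet, Fin (m e)) ℂ) (w : V)
    {z z' : ∀ e : G.edgeSet, Fin (m e)} (h : ∀ e : G.edgeSet, w ∈ (e : Sym2 V) → z e = z' e) :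
    pauliPhase r v χ w z = pauliPhase r v χ w z' := by
  refine Finset.prod_congr rfl fun e _ => ?_
  by_cases hw : w ∈ (e : Sym2 V)
  · rw [h e hw]
  · rw [if_neg hw, if_neg hw]

theorem pauliPhase_unimodular (v : V) (χ : AddChar (∀ e : G.edgeSet, Fin (m e)) ℂ) (w : V)
    (z : ∀ e : G.edgeSet, Fin (m e)) : star (pauliPhase r v χ w z) * pauliPhase r v χ w z = 1 := by
  rw [pauliPhase, star_prod, ← Finset.prod_mul_distrib]
  refine Finset.prod_eq_one fun e _ => ?_
  split_ifs
  · exact addChar_star_mul_self χ _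
  · exact addChar_star_mul_self χ _
  · simp

theorem pauliPhase_self (v : V) (χ : AddChar (∀ e : G.edgeSet, Fin (m e)) ℂ)
    (z : ∀ e : G.edgeSet, Fin (m e)) :
    pauliPhase r v χ v z = χ ((childEdges r v).piecewise z 0) := by
  have h : (childEdges r v).piecewise z 0 = ∑ e ∈ childEdges r v, Pi.single e (z e) := by
    ext1 f
    rw [Finset.sum_apply]
    by_cases hf : f ∈ childEdges r v
    · rw [Finset.piecewise_eq_of_mem _ _ _ hf, Finset.sum_eq_single_of_mem f hf, Pi.single_eq_same]
      intro e _ hne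
      rw [Pi.single_eq_of_ne hne.symm]
    · rw [Finset.piecewise_eq_of_notMem _ _ _ hf, Finset.sum_eq_zero, Pi.zero_apply]
      intro e he
      rw [Pi.single_eq_of_ne]
      rintro rfl
      exact hf he
  have hχ : ∀ C : Finset G.edgeSet, χ (∑ e ∈ C, Pi.single e (z e)) =
      ∏ e ∈ C, χ (Pi.single e (z e)) := by
    intro C
    induction C using Finset.induction_on with
    | empty => simp
    | insert a C ha ih => rw [Finset.sum_insert ha, Finset.prod_insert ha, AddChar.map_add_eq_mul, ih]
  rw [h, hχ]
  refine Finset.prod_congr rfl fun e he => ?_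
  rw [if_pos (mem_childEdges.1 he).1, if_pos rfl]

/-- On each child edge the character at `v` meets its inverse at the child. -/
theorem prod_pauliPhase (hG : G.IsTree) (v : V) (χ : AddChar (∀ e : G.edgeSet, Fin (m e)) ℂ)
    (z : ∀ e : G.edgeSet, Fin (m e)) : ∏ w, pauliPhase r v χ w z = 1 := by
  simp only [pauliPhase]
  rw [Finset.prod_comm]
  refine Finset.prod_eq_one fun e he => ?_
  obtain ⟨a, b, hab⟩ := exists_isParentEdge_of_edge r hG e
  obtain rfl := hab.mem_childEdges_iff.1 he
  have hne : v ≠ b := by rintro rfl; exact hab.2.1 hab.2.2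
  rw [Finset.prod_eq_mul v b hne]
  · rw [if_pos hab.left_mem, if_pos rfl, if_pos hab.right_mem, if_neg hne.symm,
      ← AddChar.map_add_eq_mul, add_neg_cancel, AddChar.map_zero_eq_one]
  · intro c _ hc
    rw [if_neg]
    intro hce
    rcases hab.eq_or_eq hce with h | h
    · exact hc.1 h
    · exact hc.2 h
  · simp
  · simp

theorem pauliOp_isometry (v : V) (s : ∀ e : G.edgeSet, Fin (m e))
    (χ : AddChar (∀ e : G.edgeSet, Fin (m e)) ℂ) (w : V) :
    (pauliOp r v s χ w)ᴴ * pauliOp r v s χ w = 1 := by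
  refine monomialMatrix_isometry ?_ fun y => pauliPhase_unimodular v χ w _
  intro y y' h
  ext1 e
  exact add_right_cancel (congrFun h e)

theorem pauliOp_eq_one {v w : V} (hw : ∀ e ∈ childEdges (G := G) r v, w ∉ (e : Sym2 V))
    (s : ∀ e : G.edgeSet, Fin (m e)) (χ : AddChar (∀ e : G.edgeSet, Fin (m e)) ℂ) :
    pauliOp r v s χ w = 1 := by
  refine monomialMatrix_eq_one (fun y => ?_) fun y => ?_
  · ext1 e
    rw [Finset.piecewise_eq_of_notMem _ _ _ fun he => hw _ he e.2]
    simp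
  · exact Finset.prod_eq_one fun e he => if_neg (hw e he)

theorem pauliOp_apply_localLabel (v : V) (s : ∀ e : G.edgeSet, Fin (m e))
    (χ : AddChar (∀ e : G.edgeSet, Fin (m e)) ℂ) (w : V) (z : (resourceSystem G m w).Idx)
    (l : ∀ e : G.edgeSet, Fin (m e)) :
    pauliOp r v s χ w z (localLabel l w) =
      (1 : Matrix (resourceSystem G m w).Idx (resourceSystem G m w).Idx ℂ) z
        (localLabel (l + (childEdges r v).piecewise s 0) w) * pauliPhase r v χ w l := by
  have h : (fun e => localLabel l w e + (childEdges r v).piecewise s 0 e.1) =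
    localLabel (l + (childEdges r v).piecewise s 0) w := rfl
  rw [pauliOp, monomialMatrix, Matrix.of_apply, Matrix.one_apply,
    pauliPhase_congr χ w (z' := l) fun e he => extendLabel_localLabel l he, ite_mul, one_mul,
    zero_mul, h]


/-- The phases cancel, and shifting both ends of an edge by the same amount only permutes the labels
in the sum. -/
theorem sum_prod_pauliOp (hG : G.IsTree) (v : V) (s : ∀ e : G.edgeSet, Fin (m e))
    (χ : AddChar (∀ e : G.edgeSet, Fin (m e)) ℂ) (x : Joint (resourceSystem G m)) :
    ∑ l : ∀ e : G.edgeSet, Fin (m e), ∏ w, pauliOp r v s χ w (x w) (localLabel l w) =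
      ∑ l : ∀ e : G.edgeSet, Fin (m e), ∏ w,
        (1 : Matrix (resourceSystem G m w).Idx (resourceSystem G m w).Idx ℂ) (x w)
          (localLabel l w) := by
  simp only [pauliOp_apply_localLabel, Finset.prod_mul_distrib, prod_pauliPhase hG, mul_one]
  exact Equiv.sum_comp (Equiv.addRight ((childEdges r v).piecewise s 0))
    fun l : ∀ e : G.edgeSet, Fin (m e) => ∏ w,
      (1 : Matrix (resourceSystem G m w).Idx (resourceSystem G m w).Idx ℂ) (x w) (localLabel l w)

theorem tensorOp_pauliOp_mulVec (hG : G.IsTree) (v : V) (s : ∀ e : G.edgeSet, Fin (m e))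
    (χ : AddChar (∀ e : G.edgeSet, Fin (m e)) ℂ) :
    tensorOp (pauliOp r v s χ) *ᵥ resourceState G m = resourceState G m := by
  have h1 : tensorOp (fun v =>
      (1 : Matrix (resourceSystem G m v).Idx (resourceSystem G m v).Idx ℂ)) *ᵥ resourceState G m =
      resourceState G m := by
    rw [tensorOp_one, Matrix.one_mulVec]
  refine Eq.trans (funext fun x => ?_) h1
  have h2 := tensorOp_mulVec_resourceState (T := resourceSystem G m) (pauliOp r v s χ) x
  have h3 := tensorOp_mulVec_resourceState (T := resourceSystem G m)
    (fun w => (1 : Matrix (resourceSystem G m w).Idx (resourceSystem G m w).Idx ℂ)) x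
  refine h2.trans (Eq.trans ?_ h3.symm)
  rw [sum_prod_pauliOp hG]

end Pauli

/-! ### Vertex tensors as measurement operators -/

section VertexOp

variable {V : Type} [Fintype V] [DecidableEq V] {G : SimpleGraph V} [DecidableRel G.Adj]
  {m : G.edgeSet → ℕ+} {r : V} {T : V → LocalSystem} [∀ v, Nonempty (T v).Idx]
  {ψ : Joint T → ℂ} {w : ∀ e : G.edgeSet, Fin (m e) → Joint T → ℂ}

variable (r ψ w) in
/-- The tensor at the vertex `v` as an operator from the resource systems of the party `v` to its
target system. -/
noncomputable def vertexOp (v : V) : Matrix (T v).Idx (resourceSystem G m v).Idx ℂ :=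
  -- For Schmidt families on a tree only the coordinate at `v` matters
  -- (`vertexTensor_dependsOn_coord`), so the others are filled arbitrarily.
  Matrix.of fun a y => vertexTensor (α := fun v => (T v).Idx) (β := fun e => Fin (m e)) r ψ w v
    (Function.update (fun _ => Classical.arbitrary _) v a) (extendLabel y)

theorem vertexOp_apply (hG : G.IsTree)
    (hw : ∀ e, IsSchmidtFamily (α := fun v => (T v).Idx) ψ (farSide G r e) (w e)) (v : V)
    (x : Joint T) (y : (resourceSystem G m v).Idx) (l : ∀ e : G.edgeSet, Fin (m e))
    (h : ∀ (e : G.edgeSet) (he : v ∈ (e : Sym2 V)), y ⟨e, he⟩ = l e) :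
    vertexOp r ψ w v (x v) y =
      vertexTensor (α := fun v => (T v).Idx) (β := fun e => Fin (m e)) r ψ w v x l := by
  have h1 := vertexTensor_dependsOn_coord (α := fun v => (T v).Idx) (β := fun e => Fin (m e)) hG hw
    v l (x := Function.update (fun _ => Classical.arbitrary _) v (x v)) (y := x) (by
      intro i hi
      rw [Set.mem_singleton_iff] at hi
      subst hi
      simp)
  refine Eq.trans ?_ h1
  refine vertexTensor_dependsOn_label (α := fun v => (T v).Idx) (β := fun e => Fin (m e)) v _ ?_
  intro e he
  rw [extendLabel_of_mem y he, h e he]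

/-- Characters remove the terms off-diagonal in the child labels, and shifts average the diagonal
ones. On the parent edge the tensor is already isometric up to a scalar. -/
theorem sum_vertexOp_pauliOp (hG : G.IsTree) (hψ : ψ ≠ 0)
    (hw : ∀ e, IsSchmidtFamily (α := fun v => (T v).Idx) ψ (farSide G r e) (w e)) (v : V) :
    ∃ K : ℝ, 0 < K ∧ ∑ j : (∀ e : G.edgeSet, Fin (m e)) × AddChar (∀ e : G.edgeSet, Fin (m e)) ℂ,
      (vertexOp r ψ w v * pauliOp r v j.1 j.2 v)ᴴ * (vertexOp r ψ w v * pauliOp r v j.1 j.2 v) =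
        (K : ℂ) • (1 : Matrix (resourceSystem G m v).Idx (resourceSystem G m v).Idx ℂ) := by
  obtain ⟨κ, hκ, hiso⟩ := vertexTensor_isometry (α := fun v => (T v).Idx)
    (β := fun e => Fin (m e)) hG hψ hw v
  set N : ℕ := Fintype.card (∀ e : G.edgeSet, Fin (m e)) with hN
  have hN0 : 0 < N := Fintype.card_pos
  set t : ℕ := Fintype.card (T v).Idx with ht
  have ht0 : 0 < t := Fintype.card_pos
  -- One `N` comes from the sum over characters, the other from the sum over shifts; `t` turns the
  -- average over the local basis into a sum. Outcomes range over the labels of all edges, so those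
  -- differing only off the child edges repeat.
  refine ⟨N * (N * (t * κ)), by positivity, ?_⟩
  set C := childEdges (G := G) r v with hC
  ext y y'
  have hshift : ∀ (s : ∀ e : G.edgeSet, Fin (m e)) (y : (resourceSystem G m v).Idx) (x : Joint T),
      vertexOp r ψ w v (x v) (fun e => y e + C.piecewise s 0 e.1) =
        vertexTensor (α := fun v => (T v).Idx) (β := fun e => Fin (m e)) r ψ w v x
          (C.piecewise (extendLabel y + s) (extendLabel y)) := by
    intro s y x
    refine vertexOp_apply hG hw v x _ _ fun e he => ?_
    by_cases hec : e ∈ C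
    · rw [Finset.piecewise_eq_of_mem _ _ _ hec, Finset.piecewise_eq_of_mem _ _ _ hec, Pi.add_apply,
        extendLabel_of_mem y he]
    · rw [Finset.piecewise_eq_of_notMem _ _ _ hec, Finset.piecewise_eq_of_notMem _ _ _ hec,
        extendLabel_of_mem y he, Pi.zero_apply, add_zero]
  have hphase : ∑ χ : AddChar (∀ e : G.edgeSet, Fin (m e)) ℂ,
      star (pauliPhase r v χ v (extendLabel y)) * pauliPhase r v χ v (extendLabel y') =
      if ∀ e ∈ C, extendLabel y e = extendLabel y' e then (N : ℂ) else 0 := by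
    have h : ∀ χ : AddChar (∀ e : G.edgeSet, Fin (m e)) ℂ,
        star (pauliPhase r v χ v (extendLabel y)) * pauliPhase r v χ v (extendLabel y') =
        χ (-C.piecewise (extendLabel y) 0 + C.piecewise (extendLabel y') 0) := by
      intro χ
      rw [pauliPhase_self, pauliPhase_self, AddChar.map_add_eq_mul, AddChar.map_neg_eq_conj]
      rfl
    simp only [h]
    rw [AddChar.sum_apply_eq_ite]
    refine if_congr ?_ rfl rfl
    rw [neg_add_eq_zero, funext_iff]
    refine forall_congr' fun e => ?_
    by_cases hec : e ∈ C
    · simp [hec]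
    · simp [hec]
  have hval : ∀ (s : ∀ e : G.edgeSet, Fin (m e)) (χ : AddChar (∀ e : G.edgeSet, Fin (m e)) ℂ),
      ((vertexOp r ψ w v * pauliOp r v s χ v)ᴴ * (vertexOp r ψ w v * pauliOp r v s χ v)) y y' =
      (star (pauliPhase r v χ v (extendLabel y)) * pauliPhase r v χ v (extendLabel y')) *
      (t * 𝔼 x : Joint T, star (vertexTensor (α := fun v => (T v).Idx) (β := fun e => Fin (m e))
          r ψ w v x (C.piecewise (extendLabel y + s) (extendLabel y))) *
        vertexTensor (α := fun v => (T v).Idx) (β := fun e => Fin (m e))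
          r ψ w v x (C.piecewise (extendLabel y' + s) (extendLabel y'))) := by
    intro s χ
    simp only [← hshift]
    rw [expect_apply_coord (α := fun v => (T v).Idx) v fun a =>
      star (vertexOp r ψ w v a (fun e => y e + C.piecewise s 0 e.1)) *
        vertexOp r ψ w v a (fun e => y' e + C.piecewise s 0 e.1), ht, Fintype.card_mul_expect,
      Matrix.mul_apply, Finset.mul_sum]
    refine Finset.sum_congr rfl fun a _ => ?_
    rw [Matrix.conjTranspose_apply, pauliOp, mul_monomialMatrix, mul_monomialMatrix, star_mul']
    ring
  rw [Matrix.sum_apply, Fintype.sum_prod_type]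
  simp only [hval]
  simp only [← Finset.sum_mul, hphase]
  rw [← Finset.mul_sum, ← Finset.mul_sum, Matrix.smul_apply, smul_eq_mul]
  by_cases hCy : ∀ e ∈ C, extendLabel y e = extendLabel y' e
  · rw [if_pos hCy]
    have h1 : ∀ s, C.piecewise (extendLabel y' + s) (extendLabel y') =
        C.piecewise (extendLabel y + s) (extendLabel y') := by
      intro s
      ext1 e
      by_cases hec : e ∈ C
      · rw [Finset.piecewise_eq_of_mem _ _ _ hec, Finset.piecewise_eq_of_mem _ _ _ hec,
          Pi.add_apply, Pi.add_apply, hCy e hec]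
      · rw [Finset.piecewise_eq_of_notMem _ _ _ hec, Finset.piecewise_eq_of_notMem _ _ _ hec]
    simp only [h1]
    -- Translating the shift by `extendLabel y` gives the average over child labels in
    -- `vertexTensor_isometry`.
    have h3 := Equiv.sum_comp (Equiv.addLeft (extendLabel y)) fun s : ∀ e : G.edgeSet, Fin (m e) =>
      𝔼 x : Joint T, star (vertexTensor (α := fun v => (T v).Idx) (β := fun e => Fin (m e))
          r ψ w v x (C.piecewise s (extendLabel y))) *
        vertexTensor (α := fun v => (T v).Idx) (β := fun e => Fin (m e))
          r ψ w v x (C.piecewise s (extendLabel y'))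
    simp only [Equiv.coe_addLeft] at h3
    rw [h3, ← Fintype.card_mul_expect, hiso, Matrix.one_apply]
    have h2 : (∀ e : G.edgeSet, v ∈ (e : Sym2 V) → v ∈ farSide G r e →
        extendLabel y e = extendLabel y' e) ↔ y = y' := by
      constructor
      · intro h
        ext1 e
        obtain ⟨e, he⟩ := e
        rw [← extendLabel_of_mem y he, ← extendLabel_of_mem y' he]
        by_cases hf : v ∈ farSide G r e
        · exact h e he hf
        · exact hCy e (mem_childEdges.2 ⟨he, hf⟩)
      · rintro rfl _ _ _; rfl
    rw [if_congr h2 rfl rfl, ← hN]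
    split_ifs <;> push_cast <;> ring
  · rw [if_neg hCy, zero_mul, Matrix.one_apply_ne, mul_zero]
    rintro rfl
    exact hCy fun _ _ => rfl

theorem tensorOp_vertexOp_mulVec (hG : G.IsTree)
    (hw : ∀ e, IsSchmidtFamily (α := fun v => (T v).Idx) ψ (farSide G r e) (w e)) (γ : V → ℂ) :
    ∃ c : ℂ, tensorOp (fun v => γ v • vertexOp r ψ w v) *ᵥ resourceState G m = c • ψ := by
  refine ⟨(∏ e : G.edgeSet, ((1 / √(m e : ℝ) : ℝ) : ℂ)) *
    ((∏ v, γ v) * Fintype.card (∀ e : G.edgeSet, Fin (m e))), funext fun x => ?_⟩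
  refine (tensorOp_mulVec_resourceState (T := T) (fun v => γ v • vertexOp r ψ w v) x).trans ?_
  rw [Pi.smul_apply, smul_eq_mul, mul_assoc, mul_assoc]
  congr 1
  conv_rhs => rw [eq_expect_prod_vertexTensor (α := fun v => (T v).Idx)
    (β := fun e => Fin (m e)) hG hw x, Fintype.card_mul_expect, Finset.mul_sum]
  refine Finset.sum_congr rfl fun l _ => ?_
  rw [← Finset.prod_mul_distrib]
  refine Finset.prod_congr rfl fun v _ => ?_
  rw [Matrix.smul_apply, smul_eq_mul, vertexOp_apply hG hw v x _ l fun _ _ => rfl]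

end VertexOp

/-! ### The protocol from the root down -/

section Protocol

/-- The operator `M` if it has already been applied, and the identity otherwise. -/
def partialOp {T D : LocalSystem} (M : Matrix T.Idx D.Idx ℂ) :
    (b : Bool) → Matrix (cond b T D).Idx D.Idx ℂ
  | true => M
  | false => (1 : Matrix D.Idx D.Idx ℂ)

/-- The operator of one round: `U` without `M`, or `M * U` if `M` is applied in this round. -/
def roundOp {T D : LocalSystem} (M : Matrix T.Idx D.Idx ℂ) (U : Matrix D.Idx D.Idx ℂ) :
    (b b' : Bool) → Matrix (cond b' T D).Idx (cond b T D).Idx ℂ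
  | true, true => (1 : Matrix T.Idx T.Idx ℂ)
  | true, false => (0 : Matrix D.Idx T.Idx ℂ)
  | false, true => M * U
  | false, false => U

/-- This moves the Pauli operators of a round back in front of all earlier measurements, where the
resource state absorbs them. It needs them to be trivial at the parties that have already measured.
-/
theorem roundOp_mul_partialOp {T D : LocalSystem} (M : Matrix T.Idx D.Idx ℂ)
    (U : Matrix D.Idx D.Idx ℂ) {b b' : Bool} (h : b = true → b' = true ∧ U = 1) :
    roundOp M U b b' * partialOp M b = partialOp M b' * U := by
  cases b
  · cases b'
    · exact (mul_one U).trans (one_mul U).symm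
    · exact Matrix.mul_one (M * U)
  · obtain ⟨rfl, rfl⟩ := h rfl
    exact (Matrix.one_mul M).trans (Matrix.mul_one M).symm

theorem roundOp_isometry {T D : LocalSystem} (M : Matrix T.Idx D.Idx ℂ)
    {U : Matrix D.Idx D.Idx ℂ} (hU : Uᴴ * U = 1) {b b' : Bool} (h : b = b') :
    (roundOp M U b b')ᴴ * roundOp M U b b' = 1 := by
  subst h
  cases b
  · exact hU
  · change (1 : Matrix T.Idx T.Idx ℂ)ᴴ * (1 : Matrix T.Idx T.Idx ℂ) = 1
    rw [Matrix.conjTranspose_one, one_mul]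

theorem sum_roundOp {T D : LocalSystem} {J : Type} [Fintype J] (M : Matrix T.Idx D.Idx ℂ)
    (U : J → Matrix D.Idx D.Idx ℂ) (hU : ∑ j, (M * U j)ᴴ * (M * U j) = 1) {b b' : Bool}
    (hb : b = false) (hb' : b' = true) :
    ∑ j, (roundOp M (U j) b b')ᴴ * roundOp M (U j) b b' = 1 := by
  subst hb hb'
  exact hU

variable {V : Type} [Fintype V] [DecidableEq V] {G : SimpleGraph V} [DecidableRel G.Adj]
  {m : G.edgeSet → ℕ+} {r : V} {T : V → LocalSystem}

/-- The systems of the parties after the parties with `b v = true` have measured. -/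
abbrev partialSystem (m : G.edgeSet → ℕ+) (T : V → LocalSystem) (b : V → Bool) (v : V) :
    LocalSystem :=
  cond (b v) (T v) (resourceSystem G m v)

/-- The state after the parties with `b v = true` have applied `M v`. -/
noncomputable def partialState (M : ∀ v, Matrix (T v).Idx (resourceSystem G m v).Idx ℂ)
    (b : V → Bool) : Joint (partialSystem m T b) → ℂ :=
  tensorOp (E := partialSystem m T b) (fun v => partialOp (M v) (b v)) *ᵥ resourceState G m

theorem partialState_false (M : ∀ v, Matrix (T v).Idx (resourceSystem G m v).Idx ℂ) :
    partialState M (fun _ => false) = resourceState G m := by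
  have h : tensorOp (fun v => (1 : Matrix (resourceSystem G m v).Idx
      (resourceSystem G m v).Idx ℂ)) *ᵥ resourceState G m = resourceState G m := by
    rw [tensorOp_one, Matrix.one_mulVec]
  exact h

theorem tensorOp_roundOp_mulVec_partialState (hG : G.IsTree)
    (M : ∀ v, Matrix (T v).Idx (resourceSystem G m v).Idx ℂ) {v : V} {b b' : V → Bool}
    (hbv : b v = false) (hbb' : ∀ w, b w = true → b' w = true)
    (hchild : ∀ w e, IsParentEdge (G := G) r v w e → b w = false)
    (s : ∀ e : G.edgeSet, Fin (m e)) (χ : AddChar (∀ e : G.edgeSet, Fin (m e)) ℂ) :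
    tensorOp (D := partialSystem m T b) (E := partialSystem m T b')
      (fun w => roundOp (M w) (pauliOp r v s χ w) (b w) (b' w)) *ᵥ partialState M b =
      partialState M b' := by
  have h : (fun w => roundOp (M w) (pauliOp r v s χ w) (b w) (b' w) * partialOp (M w) (b w)) =
      fun w => partialOp (M w) (b' w) * pauliOp r v s χ w := by
    funext w
    refine roundOp_mul_partialOp (M w) _ fun hw => ⟨hbb' w hw, pauliOp_eq_one ?_ _ _⟩
    intro e he hwe
    obtain ⟨a, d, had⟩ := exists_isParentEdge_of_edge r hG e
    obtain rfl := had.mem_childEdges_iff.1 he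
    rcases had.eq_or_eq hwe with rfl | rfl
    · rw [hbv] at hw; exact Bool.false_ne_true hw
    · rw [hchild _ _ had] at hw; exact Bool.false_ne_true hw
  have h1 := tensorOp_mul (D := resourceSystem G m) (E := partialSystem m T b)
    (F := partialSystem m T b') (fun w => roundOp (M w) (pauliOp r v s χ w) (b w) (b' w))
    (fun w => partialOp (M w) (b w))
  have h2 := tensorOp_mul (D := resourceSystem G m) (E := resourceSystem G m)
    (F := partialSystem m T b') (fun w => partialOp (M w) (b' w)) (fun w => pauliOp r v s χ w)
  rw [partialState, partialState, Matrix.mulVec_mulVec, h1, h, ← h2, ← Matrix.mulVec_mulVec]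
  congr 1
  exact tensorOp_pauliOp_mulVec hG v s χ

/-- If the local operators `M v` can be completed to measurements by Pauli corrections, then they
are implemented by an LOCC protocol that visits the vertices of the tree from the root down. -/
theorem exists_locc_of_vertex_measurements (hG : G.IsTree)
    (M : ∀ v, Matrix (T v).Idx (resourceSystem G m v).Idx ℂ)
    (hM : ∀ v, ∑ j : (∀ e : G.edgeSet, Fin (m e)) × AddChar (∀ e : G.edgeSet, Fin (m e)) ℂ,
      (M v * pauliOp r v j.1 j.2 v)ᴴ * (M v * pauliOp r v j.1 j.2 v) = 1) :
    ∃ (c : ℂ) (P : LOCC T (resourceSystem G m)), P.channel (pureState (resourceState G m)) =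
      c • pureState (tensorOp M *ᵥ resourceState G m) := by
  -- A round is prefixed to the protocol that follows it, so the induction carries an arbitrary
  -- continuation `P` from the state in which exactly the parties in `S` have measured.
  have key : ∀ S : Finset V, ParentClosed G r S → ∀ b : V → Bool, (∀ v, b v = true ↔ v ∈ S) →
      ∀ P : LOCC T (partialSystem m T b),
      ∃ (c : ℂ) (P' : LOCC T (resourceSystem G m)),
        P'.channel (pureState (resourceState G m)) =
          c • P.channel (pureState (partialState M b)) := by
    intro S hS
    refine parentClosed_induction (G := G) (r := r) (motive := fun S => ∀ b : V → Bool,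
      (∀ v, b v = true ↔ v ∈ S) → ∀ P : LOCC T (partialSystem m T b),
      ∃ (c : ℂ) (P' : LOCC T (resourceSystem G m)),
        P'.channel (pureState (resourceState G m)) =
          c • P.channel (pureState (partialState M b))) ?_ ?_ S hS
    · intro b hb P
      have hb' : b = fun _ => false := by
        funext v
        simpa using hb v
      subst hb'
      refine ⟨1, P, ?_⟩
      rw [one_smul, partialState_false]
    · intro v S hvS hS hS' hchild ih b' hb' P
      obtain ⟨b, hb⟩ : ∃ b : V → Bool, ∀ v, b v = true ↔ v ∈ S :=
        ⟨fun v => decide (v ∈ S), fun v => by simp⟩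
      have hbf : ∀ w, w ∉ S → b w = false := fun w hw =>
        Bool.eq_false_iff.2 fun h => hw ((hb w).1 h)
      have hcomplete := sum_roundOp (T := T v) (D := resourceSystem G m v)
        (J := (∀ e : G.edgeSet, Fin (m e)) × AddChar (∀ e : G.edgeSet, Fin (m e)) ℂ) (M v)
        (fun j => pauliOp r v j.1 j.2 v) (hM v) (hbf v hvS)
        ((hb' v).2 (Finset.mem_insert_self v S))
      have hiso (j : (∀ e : G.edgeSet, Fin (m e)) × AddChar (∀ e : G.edgeSet, Fin (m e)) ℂ)
          (w : V) (hwv : w ≠ v) :=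
        roundOp_isometry (T := T w) (D := resourceSystem G m w) (M w)
          (pauliOp_isometry (r := r) v j.1 j.2 w) (b := b w) (b' := b' w) (by
          rw [Bool.eq_iff_iff, hb w, hb' w, Finset.mem_insert, or_iff_right hwv])
      obtain ⟨P₁, hP₁⟩ := P.exists_round (D := partialSystem m T b) v
        (fun (j : (∀ e : G.edgeSet, Fin (m e)) × AddChar (∀ e : G.edgeSet, Fin (m e)) ℂ) w =>
          roundOp (M w) (pauliOp r v j.1 j.2 w) (b w) (b' w))
        hcomplete hiso
        (fun j => tensorOp_roundOp_mulVec_partialState hG M (hbf v hvS)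
          (fun w hw => (hb' w).2 (Finset.mem_insert_of_mem ((hb w).1 hw)))
          (fun w e h => hbf w (hchild w e h)) j.1 j.2)
      obtain ⟨c, P₂, hP₂⟩ := ih b hb P₁
      rw [hP₁, smul_smul] at hP₂
      exact ⟨_, P₂, hP₂⟩
  -- For `b` constantly true the systems are `T` by definition, so the empty protocol is a
  -- continuation.
  exact key Finset.univ (fun _ _ _ _ _ => Finset.mem_univ _) (fun _ => true) (by simp) LOCC.done

/-- The scalar accumulated by the protocol need not be computed: the channel preserves the trace and
both states have trace one, so it equals one. -/
theorem mem_constructibleFrom_of_isSchmidtFamily (hG : G.IsTree) [∀ v, Nonempty (T v).Idx]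
    {ψ : Joint T → ℂ} (hψ : (pureState ψ).trace = 1) {w : ∀ e : G.edgeSet, Fin (m e) → Joint T → ℂ}
    (hw : ∀ e, IsSchmidtFamily (α := fun v => (T v).Idx) ψ (farSide G r e) (w e)) :
    m ∈ constructibleFrom G (pureState ψ) := by
  have hψ0 : ψ ≠ 0 := by
    rintro rfl
    simp [trace_pureState] at hψ
  choose K hK hsum using sum_vertexOp_pauliOp hG hψ0 hw
  -- Dividing by `√(K v)` normalizes the measurement of `v` to the identity.
  set γ : V → ℂ := fun v => ((1 / √(K v) : ℝ) : ℂ) with hγ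
  have hγK : ∀ v, star (γ v) * γ v * K v = 1 := by
    intro v
    rw [hγ, RCLike.star_def, Complex.conj_ofReal, ← Complex.ofReal_mul, ← Complex.ofReal_mul,
      ← sq, div_pow, Real.sq_sqrt (hK v).le, one_pow, one_div, inv_mul_cancel₀ (hK v).ne',
      Complex.ofReal_one]
  obtain ⟨c, P, hP⟩ := exists_locc_of_vertex_measurements (r := r) hG
    (fun v => γ v • vertexOp r ψ w v) (by
      intro v
      simp only [Matrix.smul_mul, Matrix.conjTranspose_smul, Matrix.mul_smul, smul_smul]
      rw [← Finset.smul_sum, hsum, smul_smul, mul_comm (γ v), hγK, one_smul])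
  obtain ⟨c', hc'⟩ := tensorOp_vertexOp_mulVec (r := r) hG hw γ
  rw [hc', pureState_smul, smul_smul] at hP
  have htr := congrArg Matrix.trace hP
  rw [LOCC.trace_channel, trace_pureState_resourceState, Matrix.trace_smul, hψ, smul_eq_mul,
    mul_one] at htr
  rw [← htr, one_smul] at hP
  exact ⟨P, hP⟩

end Protocol

/-! ### Schmidt ranks bound every feasible family -/

section LowerBound

variable {V : Type} [Fintype V] [DecidableEq V] {G : SimpleGraph V} [DecidableRel G.Adj]
  {m : G.edgeSet → ℕ+} {r : V} {T : V → LocalSystem}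

theorem expect_eq_expect_update {E : Type} [Fintype E] [DecidableEq E] {β : E → Type}
    [∀ e, Fintype (β e)] [∀ e, Nonempty (β e)] (e : E) (k : (∀ e, β e) → ℂ) :
    𝔼 l, k l = 𝔼 t, 𝔼 l, k (Function.update l e t) := by
  rw [← expect_apply_coord e fun t => 𝔼 l, k (Function.update l e t), Finset.expect_comm,
    ← expect_expect_piecewise {e}]
  refine Finset.expect_congr rfl fun l _ => Finset.expect_congr rfl fun l' _ => ?_
  rw [Finset.piecewise_singleton]

/-- A product operator cannot create a Schmidt rank larger than that of the edge it crosses. -/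
theorem rank_schmidtMatrix_le_of_tensorOp (e : G.edgeSet)
    (K : ∀ v, Matrix (T v).Idx (resourceSystem G m v).Idx ℂ) (c : ℂ) {ψ : Joint T → ℂ}
    (h : ψ = c • (tensorOp K *ᵥ resourceState G m)) :
    (schmidtMatrix (α := fun v => (T v).Idx) ψ (farSide G r e)).rank ≤ m e := by
  set F := farSide G r e with hF
  obtain ⟨c', hc'⟩ : ∃ c' : ℂ, ∀ x, ψ x =
      c' * 𝔼 l : (∀ e : G.edgeSet, Fin (m e)), ∏ v, K v (x v) (localLabel l v) := by
    refine ⟨c * (∏ e : G.edgeSet, ((1 / √(m e : ℝ) : ℝ) : ℂ)) *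
      Fintype.card (∀ e : G.edgeSet, Fin (m e)), fun x => ?_⟩
    rw [mul_assoc, Fintype.card_mul_expect, h, Pi.smul_apply, smul_eq_mul,
      tensorOp_mulVec_resourceState, mul_assoc]
  let a : Joint T → Fin (m e) → ℂ := fun x t => 𝔼 l : (∀ e : G.edgeSet, Fin (m e)),
    ∏ v ∈ F, K v (x v) (localLabel (Function.update l e t) v)
  let b : Joint T → Fin (m e) → ℂ := fun z t => 𝔼 l : (∀ e : G.edgeSet, Fin (m e)),
    ∏ v ∈ Fᶜ, K v (z v) (localLabel (Function.update l e t) v)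
  have hlabel : ∀ (S : Finset V) (x : Joint T) (t : Fin (m e)),
      DependsOn (fun l : ∀ e : G.edgeSet, Fin (m e) =>
        ∏ v ∈ S, K v (x v) (localLabel (Function.update l e t) v))
        (({f : G.edgeSet | f ≠ e ∧ ∃ v ∈ S, v ∈ (f : Sym2 V)} : Finset G.edgeSet) :
          Set G.edgeSet) := by
    intro S x t l l' hl
    refine Finset.prod_congr rfl fun v hv => ?_
    congr 1
    ext1 f
    obtain ⟨f, hf⟩ := f
    change Function.update l e t f = Function.update l' e t f
    rcases eq_or_ne f e with rfl | hne
    · rw [Function.update_self, Function.update_self]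
    · rw [Function.update_of_ne hne, Function.update_of_ne hne]
      exact hl f (by simpa using ⟨hne, v, hv, hf⟩)
  have hdisj : Disjoint ({f : G.edgeSet | f ≠ e ∧ ∃ v ∈ F, v ∈ (f : Sym2 V)} : Finset G.edgeSet)
      ({f : G.edgeSet | f ≠ e ∧ ∃ v ∈ Fᶜ, v ∈ (f : Sym2 V)} : Finset G.edgeSet) := by
    rw [Finset.disjoint_left]
    intro f hf hf'
    simp only [Finset.mem_filter, Finset.mem_univ, true_and] at hf hf'
    obtain ⟨hne, u, hu, huf⟩ := hf
    obtain ⟨-, w, hw, hwf⟩ := hf'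
    rw [Finset.mem_compl] at hw
    exact hw ((mem_farSide_iff_of_ne r hne huf hwf).1 hu)
  -- With the label `t` of `e` fixed, every remaining edge lies on one side of the cut, so the
  -- contraction splits into `a x t * b z t`. The coefficient matrix thus factors through dimension
  -- `m e`.
  have hN : schmidtMatrix (α := fun v => (T v).Idx) ψ F =
      (Matrix.of b : Matrix (Joint T) (Fin (m e)) ℂ) *
        (Matrix.of fun t x => c' / (m e : ℕ) * a x t : Matrix (Fin (m e)) (Joint T) ℂ) := by
    ext z x
    rw [schmidtMatrix, Matrix.of_apply, hc', Matrix.mul_apply, expect_eq_expect_update e,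
      Fintype.expect_eq_sum_div_card, Finset.sum_div, Finset.mul_sum]
    refine Finset.sum_congr rfl fun t _ => ?_
    rw [Matrix.of_apply, Matrix.of_apply, Fintype.card_fin]
    have h1 : 𝔼 l : (∀ e : G.edgeSet, Fin (m e)),
        ∏ v, K v (F.piecewise x z v) (localLabel (Function.update l e t) v) = a x t * b z t := by
      rw [← expect_mul_of_dependsOn hdisj (hlabel F x t) (hlabel Fᶜ z t)]
      refine Finset.expect_congr rfl fun l _ => ?_
      rw [← Finset.prod_mul_prod_compl F]
      congr 1
      · refine Finset.prod_congr rfl fun v hv => ?_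
        rw [Finset.piecewise_eq_of_mem _ _ _ hv]
      · refine Finset.prod_congr rfl fun v hv => ?_
        rw [Finset.piecewise_eq_of_notMem _ _ _ (Finset.mem_compl.1 hv)]
    rw [h1]
    ring
  rw [hN]
  refine (Matrix.rank_mul_le_left _ _).trans ((Matrix.rank_le_card_width _).trans ?_)
  rw [Fintype.card_fin]

theorem edgeRank_le_of_mem_constructibleFrom [∀ v, Nonempty (T v).Idx] {ψ : Joint T → ℂ}
    (hψ : ψ ≠ 0) (hm : m ∈ constructibleFrom G (pureState ψ)) (e : G.edgeSet) :
    edgeRank G r (pureState ψ) e ≤ m e := by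
  obtain ⟨P, hP⟩ := hm
  obtain ⟨K, c, h⟩ := P.exists_tensorOp_mulVec hψ hP
  rw [edgeRank, rank_reducedState]
  exact rank_schmidtMatrix_le_of_tensorOp e K c h

/-- Rank zero would give an empty Schmidt family, and a vector fixed by the empty average is zero.
-/
theorem edgeRank_pos [∀ v, Nonempty (T v).Idx] {ψ : Joint T → ℂ} (hψ : ψ ≠ 0) (e : G.edgeSet) :
    0 < edgeRank G r (pureState ψ) e := by
  rw [edgeRank, rank_reducedState, Nat.pos_iff_ne_zero]
  intro h0
  obtain ⟨w, hw⟩ := exists_isSchmidtFamily (α := fun v => (T v).Idx) ψ (farSide G r e) h0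
  refine hψ (funext fun x => ?_)
  rw [hw.fixed x]
  simp

end LowerBound

/-! ### The optimal configuration -/

theorem totalEntanglement_le_of_le {V : Type} [Fintype V] [DecidableEq V] {G : SimpleGraph V}
    [DecidableRel G.Adj] {m m' : G.edgeSet → ℕ+} (h : ∀ e, m e ≤ m' e) :
    totalEntanglement G m ≤ totalEntanglement G m' :=
  Finset.sum_le_sum fun e _ => Real.logb_le_logb_of_le one_lt_two
    (by exact_mod_cast (m e).pos) (by exact_mod_cast h e)

theorem eq_of_le_of_totalEntanglement_le {V : Type} [Fintype V] [DecidableEq V]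
    {G : SimpleGraph V} [DecidableRel G.Adj] {m m' : G.edgeSet → ℕ+} (h : ∀ e, m e ≤ m' e)
    (h' : totalEntanglement G m' ≤ totalEntanglement G m) : m' = m := by
  by_contra hne
  obtain ⟨e, he⟩ := Function.ne_iff.1 hne
  refine absurd h' (not_le.2 (Finset.sum_lt_sum (fun e _ => ?_) ⟨e, Finset.mem_univ e, ?_⟩))
  · exact Real.logb_le_logb_of_le one_lt_two (by exact_mod_cast (m e).pos) (by exact_mod_cast h e)
  · refine Real.logb_lt_logb one_lt_two (by exact_mod_cast (m e).pos) ?_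
    have := lt_of_le_of_ne (h e) (Ne.symm he)
    exact_mod_cast this

theorem theorem5 {V : Type} [Fintype V] [DecidableEq V]
    (G : SimpleGraph V) [DecidableRel G.Adj] (hG : G.IsTree) (r : V)
    (d : V → ℕ) (ψ : EuclideanSpace ℂ (Joint fun v => qudit (d v))) (hψ : ‖ψ‖ = 1) :
    (∃! m : G.edgeSet → ℕ+, m ∈ optimalConfigurations G (pureState ψ)) ∧
    ∀ (i : optimalConfigurations G (pureState ψ)) (e : G.edgeSet),
      exactEdgeCost G (pureState ψ) i e = Real.logb 2 (edgeRank G r (pureState ψ) e : ℝ) := by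
  have hψ0 : (ψ : Joint (fun v => qudit (d v)) → ℂ) ≠ 0 := by
    intro h0
    have : ψ = 0 := by ext x; exact congrFun h0 x
    rw [this, norm_zero] at hψ
    exact zero_ne_one hψ
  have htr : (pureState (ψ : Joint (fun v => qudit (d v)) → ℂ)).trace = 1 := by
    rw [trace_pureState]
    have h1 := EuclideanSpace.norm_sq_eq ψ
    rw [hψ, one_pow] at h1
    rw [← Complex.ofReal_one, h1, Complex.ofReal_sum]
    refine Finset.sum_congr rfl fun x _ => ?_
    rw [RCLike.star_def, Complex.mul_conj']
    push_cast
    rfl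
  obtain ⟨x₀, -⟩ := Function.ne_iff.1 hψ0
  -- A nonzero entry of `ψ` supplies a basis index for every party, which excludes `d v = 0`.
  have hne : ∀ v, Nonempty (qudit (d v)).Idx := fun v => ⟨x₀ v⟩
  let R : G.edgeSet → ℕ+ := fun e => ⟨edgeRank G r (pureState ψ) e, edgeRank_pos hψ0 e⟩
  have hR : R ∈ constructibleFrom G (pureState (ψ : Joint (fun v => qudit (d v)) → ℂ)) := by
    -- With `R e` labels on `e`, there is exactly one label for each Schmidt vector.
    have hw : ∀ e : G.edgeSet, ∃ w : Fin (R e) → Joint (fun v => qudit (d v)) → ℂ,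
        IsSchmidtFamily (α := fun v => (qudit (d v)).Idx) ψ (farSide G r e) w := fun e =>
      exists_isSchmidtFamily _ _ (rank_reducedState _ _).symm
    choose w hw using hw
    exact mem_constructibleFrom_of_isSchmidtFamily hG htr hw
  have hle : ∀ m ∈ constructibleFrom G (pureState (ψ : Joint (fun v => qudit (d v)) → ℂ)),
      ∀ e, R e ≤ m e := fun m hm e => edgeRank_le_of_mem_constructibleFrom (r := r) hψ0 hm e
  have hopt : ∀ m ∈ optimalConfigurations G (pureState (ψ : Joint (fun v => qudit (d v)) → ℂ)),
      m = R := fun m hm => eq_of_le_of_totalEntanglement_le (hle m hm.1) (hm.2 R hR)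
  refine ⟨⟨R, ⟨hR, fun m hm => totalEntanglement_le_of_le (hle m hm)⟩, hopt⟩, fun i e => ?_⟩
  rw [exactEdgeCost, hopt i.1 i.2]
  rfl
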